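/- Let $n\ge 1$ and let $a=(a_1,\dots,a_n)$ be positive real numbers. Let $$E(a)=\Bigl\{(x,\xi)\in\mathbb R^n\times\mathbb R^n:\ 2\pi\sum_{1\le j\le n}\frac{x_j^2+\xi_j^2}{a_j}\le 1\Bigr\}.$$ For $u,v\in\mathscr S(\mathbb R^n)$ set $\mathcal W(u,v)(x,\xi)=\int_{\mathbb R^n}e^{-2i\pi z\cdot\xi}\,u(x+\tfrac z2)\,\overline{v(x-\tfrac z2)}\,dz$. The Weyl quantization of the indicator function $\mathbf 1_{E(a)}$ is the bounded operator $\mathrm{Op}_w(\mathbf 1_{E(a)})$ on $L^2(\mathbb R^n)$ determined by $$\langle \mathrm{Op}_w(\mathbf 1_{E(a)})u,v\rangle_{L^2(\mathbb R^n)}=\iint_{E(a)}\mathcal W(u,v)(x,\xi)\,dx\,d\xi,\qquad u,v\in\mathscr S(\mathbb R^n).$$ For $\alpha\in\mathbb N^n$ let $\mathbb P_\alpha$ be the orthogonal projection of $L^2(\mathbb R^n)$ onto $\mathbb C\Psi_\alpha$, where $\Psi_\alpha(x)=\prod_{1\le j\le n}\psi_{\alpha_j}(x_j)$ and $\psi_k$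 is the Hermite function $$\psi_k(x)=\frac{(-1)^k}{2^k\sqrt{k!}}\,2^{1/4}\,e^{\pi x^2}\Bigl(\frac{1}{\sqrt\pi}\frac{d}{dx}\Bigr)^k\bigl(e^{-2\pi x^2}\bigr),\qquad x\in\mathbb R .$$ Let $L_k(x)=\sum_{0\le l\le k}\frac{(-1)^l}{l!}\binom kl x^l$ be the Laguerre polynomials. Then such an operator $\mathrm{Op}_w(\mathbf 1_{E(a)})$ exists, and $$\mathrm{Op}_w(\mathbf 1_{E(a)})=\sum_{\alpha\in\mathbb N^n}F_\alpha(a)\,\mathbb P_\alpha ,$$ the (unordered) sum converging in the strong operator topology of $L^2(\mathbb R^n)$, where $F_\alpha(a)=1-K_\alpha(a)$ and $$K_\alpha(a)=\int_{\sum_j t_j/a_j\ge 1,\ t_j\ge 0}e^{-(t_1+\dots+t_n)}\prod_{1\le j\le n}(-1)^{\alpha_j}L_{\alpha_j}(2t_j)\,dt ,$$ these integrals being absolutely convergent. -/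

import Mathlib

open MeasureTheory

noncomputable section

namespace WeylEllipsoid

/-- The Hilbert space `L²(ℝⁿ; ℂ)`. -/
abbrev L2 (n : ℕ) : Type := Lp ℂ 2 (volume : Measure (EuclideanSpace ℝ (Fin n)))

/-- The phase space `ℝⁿ × ℝⁿ`, with generic point `(x, ξ)`. -/
abbrev Phase (n : ℕ) : Type := EuclideanSpace ℝ (Fin n) × EuclideanSpace ℝ (Fin n)

/-! ### Wigner function and Weyl quantization -/

/-- The joint Wigner function
`W(u, v)(x, ξ) = ∫ exp(-2iπ z·ξ) u(x + z/2) conj(v(x - z/2)) dz`. -/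
def wigner {n : ℕ} (u v : EuclideanSpace ℝ (Fin n) → ℂ) (p : Phase n) : ℂ :=
  ∫ z : EuclideanSpace ℝ (Fin n),
    Complex.exp (-(2 * Real.pi * inner ℝ z p.2 : ℝ) * Complex.I) *
      (u (p.1 + (1 / 2 : ℝ) • z) * (starRingEnd ℂ) (v (p.1 - (1 / 2 : ℝ) • z)))

/-- `A` is the Weyl quantization of the symbol (a function) `b`, as a bounded operator
on `L²(ℝⁿ)`: for all Schwartz functions `u, v`,
`⟨A u, v⟩ = ∬ b(x, ξ) W(u, v)(x, ξ) dx dξ`, the integral converging absolutely.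
(Mathlib's inner product is linear in its second argument.) -/
def IsWeylQuantization {n : ℕ} (b : Phase n → ℂ) (A : L2 n →L[ℂ] L2 n) : Prop :=
  ∀ u v : SchwartzMap (EuclideanSpace ℝ (Fin n)) ℂ,
    Integrable (fun p : Phase n => b p * wigner u v p) ∧
      inner ℂ (v.toLp 2) (A (u.toLp 2)) = ∫ p : Phase n, b p * wigner u v p

/-- The ellipsoid `E(a) = {(x, ξ) : 2π ∑ⱼ (xⱼ² + ξⱼ²)/aⱼ ≤ 1}`. -/
def ellipsoid {n : ℕ} (a : Fin n → ℝ) : Set (Phase n) :=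
  {p | 2 * Real.pi * ∑ j, ((p.1 j) ^ 2 + (p.2 j) ^ 2) / a j ≤ 1}

/-! ### Hermite functions -/

/-- The one-dimensional Hermite function
`ψₖ(x) = (-1)ᵏ / (2ᵏ √k!) · 2^{1/4} · e^{πx²} · (π^{-1/2} d/dx)ᵏ e^{-2πx²}`. -/
def hermiteFun (k : ℕ) (x : ℝ) : ℝ :=
  (-1) ^ k / (2 ^ k * Real.sqrt (k.factorial)) * (2 : ℝ) ^ (1 / 4 : ℝ) *
    Real.exp (Real.pi * x ^ 2) *
      ((1 / Real.sqrt Real.pi) ^ k *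
        iteratedDeriv k (fun y : ℝ => Real.exp (-(2 * Real.pi * y ^ 2))) x)

/-- The tensor Hermite function `Ψ_α(x) = ∏ⱼ ψ_{αⱼ}(xⱼ)` on `ℝⁿ`. -/
def hermiteTensor {n : ℕ} (α : Fin n → ℕ) (x : EuclideanSpace ℝ (Fin n)) : ℂ :=
  ((∏ j, hermiteFun (α j) (x j) : ℝ) : ℂ)

theorem iteratedDeriv_gaussian (k : ℕ) :
    ∃ p : Polynomial ℝ, iteratedDeriv k (fun y : ℝ => Real.exp (-(2 * Real.pi * y ^ 2))) =
      fun x => p.eval x * Real.exp (-(2 * Real.pi * x ^ 2)) := by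
  induction k with
  | zero => exact ⟨1, by simp⟩
  | succ k ih =>
    obtain ⟨p, hp⟩ := ih
    refine ⟨Polynomial.derivative p - p * (Polynomial.C (4 * Real.pi) * Polynomial.X), ?_⟩
    rw [iteratedDeriv_succ, hp]
    funext x
    have h1 : HasDerivAt (fun y : ℝ => -(2 * Real.pi * y ^ 2)) (-(4 * Real.pi * x)) x := by
      have := ((hasDerivAt_pow 2 x).const_mul (2 * Real.pi)).neg
      refine this.congr_deriv ?_
      norm_num
      ring
    have h2 := (p.hasDerivAt x).mul h1.exp
    refine h2.deriv.trans ?_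
    simp only [Polynomial.eval_sub, Polynomial.eval_mul, Polynomial.eval_C, Polynomial.eval_X]
    ring

theorem hermiteFun_eq (k : ℕ) :
    ∃ p : Polynomial ℝ, ∀ x, hermiteFun k x = p.eval x * Real.exp (-(Real.pi * x ^ 2)) := by
  obtain ⟨p, hp⟩ := iteratedDeriv_gaussian k
  refine ⟨Polynomial.C ((-1) ^ k / (2 ^ k * Real.sqrt (k.factorial)) * (2 : ℝ) ^ (1 / 4 : ℝ) *
    (1 / Real.sqrt Real.pi) ^ k) * p, fun x => ?_⟩
  have h : Real.exp (-(Real.pi * x ^ 2)) =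
      Real.exp (Real.pi * x ^ 2) * Real.exp (-(2 * Real.pi * x ^ 2)) := by
    rw [← Real.exp_add]
    congr 1
    ring
  rw [hermiteFun, hp, h]
  simp only [Polynomial.eval_mul, Polynomial.eval_C]
  ring

theorem continuous_hermiteFun (k : ℕ) : Continuous (hermiteFun k) := by
  obtain ⟨p, hp⟩ := hermiteFun_eq k
  have : hermiteFun k = fun x => p.eval x * Real.exp (-(Real.pi * x ^ 2)) := funext hp
  rw [this]
  fun_prop

theorem integrable_poly_gaussian (p : Polynomial ℝ) :
    Integrable (fun x : ℝ => p.eval x * Real.exp (-(2 * Real.pi) * x ^ 2)) := by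
  induction p using Polynomial.induction_on' with
  | add p q hp hq =>
    refine (hp.add hq).congr (Filter.Eventually.of_forall fun x => ?_)
    simp only [Pi.add_apply, Polynomial.eval_add]
    ring
  | monomial m c =>
    have h := (integrable_rpow_mul_exp_neg_mul_sq (b := 2 * Real.pi) (by positivity)
      (s := (m : ℝ)) (by have : (0 : ℝ) ≤ m := Nat.cast_nonneg m
                         linarith)).const_mul c
    refine h.congr (Filter.Eventually.of_forall fun x => ?_)
    simp only [Polynomial.eval_monomial, Real.rpow_natCast]
    ring

theorem integrable_hermiteFun_sq (k : ℕ) : Integrable (fun x : ℝ => (hermiteFun k x) ^ 2) := by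
  obtain ⟨p, hp⟩ := hermiteFun_eq k
  refine (integrable_poly_gaussian (p ^ 2)).congr (Filter.Eventually.of_forall fun x => ?_)
  have h : Real.exp (-(2 * Real.pi) * x ^ 2) = Real.exp (-(Real.pi * x ^ 2)) ^ 2 := by
    rw [← Real.exp_nat_mul]
    congr 1
    push_cast
    ring
  simp only [hp, h, Polynomial.eval_pow]
  ring

theorem memLp_hermiteTensor {n : ℕ} (α : Fin n → ℕ) :
    MemLp (hermiteTensor α) 2 (volume : Measure (EuclideanSpace ℝ (Fin n))) := by
  have hc : Continuous (hermiteTensor α) := by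
    unfold hermiteTensor
    refine Complex.continuous_ofReal.comp (continuous_finsetProd _ fun j _ => ?_)
    exact (continuous_hermiteFun (α j)).comp (by fun_prop)
  rw [memLp_two_iff_integrable_sq_norm hc.aestronglyMeasurable]
  have h := Integrable.fintype_prod (μ := fun _ : Fin n => (volume : Measure ℝ))
    (fun j => integrable_hermiteFun_sq (α j))
  have h2 := (PiLp.volume_preserving_ofLp (Fin n)).integrable_comp_of_integrable h
  refine h2.congr (Filter.Eventually.of_forall fun x => ?_)
  simp [hermiteTensor, Finset.prod_pow, ← Finset.abs_prod]

/-- `Ψ_α` as an element of `L²(ℝⁿ)`. -/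
def hermiteL2 {n : ℕ} (α : Fin n → ℕ) : L2 n := (memLp_hermiteTensor α).toLp (hermiteTensor α)

/-- `P_α`, the orthogonal projection of `L²(ℝⁿ)` onto the line `ℂ Ψ_α`. -/
def hermiteProj {n : ℕ} (α : Fin n → ℕ) : L2 n →L[ℂ] L2 n :=
  (Submodule.span ℂ {hermiteL2 α}).starProjection

/-! ### Laguerre polynomials and the coefficients -/

/-- The Laguerre polynomial `L_k(x) = ∑_{l ≤ k} (-1)ˡ / l! · binom(k, l) xˡ`. -/
def laguerre (k : ℕ) (x : ℝ) : ℝ :=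
  ∑ l ∈ Finset.range (k + 1), (-1) ^ l / (l.factorial : ℝ) * (k.choose l : ℝ) * x ^ l

/-- The domain `{t : ∑ⱼ tⱼ/aⱼ ≥ 1, tⱼ ≥ 0}`. -/
def coeffDomain {n : ℕ} (a : Fin n → ℝ) : Set (Fin n → ℝ) :=
  {t | 1 ≤ ∑ j, t j / a j ∧ ∀ j, 0 ≤ t j}

/-- The integrand `e^{-(t₁ + ⋯ + tₙ)} ∏ⱼ (-1)^{αⱼ} L_{αⱼ}(2 tⱼ)`. -/
def coeffIntegrand {n : ℕ} (α : Fin n → ℕ) (t : Fin n → ℝ) : ℝ :=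
  Real.exp (-∑ j, t j) * ∏ j, ((-1) ^ (α j) * laguerre (α j) (2 * t j))

/-- `K_α(a)`. -/
def coeffK {n : ℕ} (α : Fin n → ℕ) (a : Fin n → ℝ) : ℝ :=
  ∫ t in coeffDomain a, coeffIntegrand α t

/-- `F_α(a) = 1 - K_α(a)`. -/
def coeffF {n : ℕ} (α : Fin n → ℕ) (a : Fin n → ℝ) : ℝ := 1 - coeffK α a

end WeylEllipsoid

end

open MeasureTheory

noncomputable section

namespace WeylEllipsoid

section

open Polynomial

/-! ### Hermite polynomials -/

/-! By Cauchy–Schwarz the Wigner function of two `L²` functions is bounded on phase space by a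
constant times the product of their norms (`exists_norm_wigner_le`). The ellipsoid has finite
measure, so integrating over it gives a bounded sesquilinear form, hence an operator
(`exists_weylOperator`); density of Schwartz functions makes it unique. What remains is to compute
its matrix in the Hermite basis.

In the coordinates `ζⱼ = xⱼ + i ξⱼ`, the Wigner function of two tensor Hermite functions is a
product of planar factors `hermiteWigner k l ζ`, found in closed form by integration by parts
(`gaussMoment_shiftedHermite`). Each factor is multiplied by `c^(l-k)` under `ζ ↦ c ζ` with `|c| =
1`. The ellipsoid is invariant under rotation of each `ζⱼ` separately, so the off-diagonal entries
vanish (`setIntegral_ellipsoid_wigner_of_ne`).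

For `k = l` the factor is `2 e^{-t} (-1)ᵏ Lₖ(2t)` with `t = 2π|ζ|²` (`hermiteWigner_self`), and `ζ ↦
π|ζ|²` carries area to length on the half-line. A diagonal entry is therefore the integral of
`coeffIntegrand` over `∑ tⱼ/aⱼ ≤ 1` in the orthant; the integral over the whole orthant is `1`, so
this is `1 - K_α(a)`.

Completeness of the Hermite functions (`eq_zero_of_inner_hermiteL2`) turns the diagonal matrix into
the strongly convergent expansion. -/

/-- The constant `2√π`. -/
def hermiteScale : ℝ := 2 * Real.sqrt Real.pi

theorem hermiteScale_pos : 0 < hermiteScale := by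
  unfold hermiteScale
  have := Real.pi_pos
  positivity

theorem hermiteScale_sq : hermiteScale ^ 2 = 4 * Real.pi := by
  rw [hermiteScale, mul_pow, Real.sq_sqrt Real.pi_pos.le]
  norm_num

/-- Hermite polynomials, normalised so that
`exp (2√π s x - s² / 2) = ∑ sᵏ / k! * hermitePoly k x`. -/
def hermitePoly : ℕ → ℝ[X]
  | 0 => 1
  | k + 1 => C hermiteScale * X * hermitePoly k - C hermiteScale⁻¹ * derivative (hermitePoly k)

/-- With `c = hermiteScale`, the commutator of `d/dX` and the raising operator `cX - c⁻¹ d/dX` is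
the constant `c`; each induction step adds one more `c`. -/
theorem derivative_hermitePoly_succ (k : ℕ) :
    derivative (hermitePoly (k + 1)) = C (hermiteScale * (k + 1)) * hermitePoly k := by
  induction k with
  | zero => simp [hermitePoly]
  | succ k ih =>
    rw [hermitePoly, derivative_sub, mul_assoc, derivative_C_mul, derivative_C_mul, derivative_mul,
      derivative_X, one_mul, ih, derivative_C_mul]
    conv_rhs => rw [hermitePoly]
    rw [hermitePoly]
    simp only [C_mul, C_add, Nat.cast_add, Nat.cast_one, C_1]
    ring

theorem derivative_hermitePoly (k : ℕ) :
    derivative (hermitePoly k) = C (hermiteScale * k) * hermitePoly (k - 1) := by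
  cases k with
  | zero => simp [hermitePoly]
  | succ k => rw [derivative_hermitePoly_succ]; simp

theorem hermitePoly_succ (k : ℕ) :
    hermitePoly (k + 1) = C hermiteScale * X * hermitePoly k - C (k : ℝ) * hermitePoly (k - 1) := by
  rw [hermitePoly, derivative_hermitePoly, ← mul_assoc, ← C_mul,
    inv_mul_cancel_left₀ hermiteScale_pos.ne']

/-- Rodrigues' formula: differentiating `p e^{-2πx²}` replaces `p` by `p' - 4πx p`, which is `-c`
times the raising operator because `c² = 4π`. -/
theorem iteratedDeriv_gaussian_eq (k : ℕ) :
    iteratedDeriv k (fun y : ℝ => Real.exp (-(2 * Real.pi * y ^ 2))) =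
      fun x => (-hermiteScale) ^ k * (hermitePoly k).eval x *
        Real.exp (-(2 * Real.pi * x ^ 2)) := by
  induction k with
  | zero => simp [hermitePoly]
  | succ k ih =>
    rw [iteratedDeriv_succ, ih]
    funext x
    have h1 : HasDerivAt (fun y : ℝ => -(2 * Real.pi * y ^ 2)) (-(4 * Real.pi * x)) x := by
      refine ((hasDerivAt_pow 2 x).const_mul (2 * Real.pi)).neg.congr_deriv ?_
      norm_num
      ring
    have h2 := (((hermitePoly k).hasDerivAt x).const_mul ((-hermiteScale) ^ k)).mul h1.exp
    refine h2.deriv.trans ?_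
    have hc := hermiteScale_pos.ne'
    simp only [hermitePoly, eval_sub, eval_mul, eval_C, eval_X]
    rw [← hermiteScale_sq]
    field_simp
    ring

theorem hermiteFun_eq_hermitePoly (k : ℕ) (x : ℝ) :
    hermiteFun k x = (2 : ℝ) ^ (1 / 4 : ℝ) / Real.sqrt k.factorial *
      ((hermitePoly k).eval x * Real.exp (-(Real.pi * x ^ 2))) := by
  have h : Real.exp (-(Real.pi * x ^ 2)) =
      Real.exp (Real.pi * x ^ 2) * Real.exp (-(2 * Real.pi * x ^ 2)) := by
    rw [← Real.exp_add]
    congr 1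
    ring
  have hp : (Real.sqrt Real.pi) ^ k ≠ 0 := by
    have := Real.pi_pos
    positivity
  have hf : Real.sqrt (k.factorial : ℝ) ≠ 0 := by positivity
  rw [hermiteFun, iteratedDeriv_gaussian_eq, h, hermiteScale, neg_pow (2 * √Real.pi), mul_pow,
    one_div_pow]
  have h1 : ((-1 : ℝ) ^ k) * (-1) ^ k = 1 := by rw [← mul_pow]; simp
  field_simp
  linear_combination (eval x (hermitePoly k)) * h1

/-! ### Gaussian moments -/

/-- The Gaussian functional `P ↦ ∫ P(z) exp(-b z² + i y z) dz`. -/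
def gaussMoment (b y : ℝ) (P : ℂ[X]) : ℂ :=
  ∫ z : ℝ, P.eval (z : ℂ) * Complex.exp (-b * z ^ 2 + Complex.I * y * z)

theorem integrable_gaussMoment {b : ℝ} (hb : 0 < b) (y : ℝ) (P : ℂ[X]) :
    Integrable (fun z : ℝ => P.eval (z : ℂ) * Complex.exp (-b * z ^ 2 + Complex.I * y * z)) := by
  induction P using Polynomial.induction_on' with
  | add p q hp hq =>
    refine (hp.add hq).congr (Filter.Eventually.of_forall fun x => ?_)
    simp only [Pi.add_apply, Polynomial.eval_add]
    ring
  | monomial m c =>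
    have h := (integrable_rpow_mul_exp_neg_mul_sq hb
      (s := (m : ℝ)) (by have : (0 : ℝ) ≤ m := Nat.cast_nonneg m
                         linarith)).norm.const_mul ‖c‖
    refine h.mono' (by fun_prop) (Filter.Eventually.of_forall fun x => ?_)
    have e : (-b * x ^ 2 + Complex.I * y * x : ℂ).re = -b * x ^ 2 := by
      have : (-b * x ^ 2 + Complex.I * y * x : ℂ)
        = ((-b * x ^ 2 : ℝ) : ℂ) + ((y * x : ℝ) : ℂ) * Complex.I := by
        push_cast; ring
      rw [this]
      simp [-Complex.ofReal_mul, -Complex.ofReal_neg, -Complex.ofReal_pow]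
    simp only [Polynomial.eval_monomial, Real.rpow_natCast, norm_mul, Complex.norm_exp, e, norm_pow,
      Complex.norm_real, Real.norm_eq_abs, Real.abs_exp]
    rw [mul_assoc]

theorem gaussMoment_add {b : ℝ} (hb : 0 < b) (y : ℝ) (P Q : ℂ[X]) :
    gaussMoment b y (P + Q) = gaussMoment b y P + gaussMoment b y Q := by
  rw [gaussMoment, gaussMoment, gaussMoment,
    ← integral_add (integrable_gaussMoment hb y P) (integrable_gaussMoment hb y Q)]
  simp only [eval_add, add_mul]

theorem gaussMoment_C_mul (b y : ℝ) (c : ℂ) (P : ℂ[X]) :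
    gaussMoment b y (C c * P) = c * gaussMoment b y P := by
  rw [gaussMoment, gaussMoment, ← integral_const_mul]
  simp only [eval_mul, eval_C, mul_assoc]

theorem gaussMoment_sub {b : ℝ} (hb : 0 < b) (y : ℝ) (P Q : ℂ[X]) :
    gaussMoment b y (P - Q) = gaussMoment b y P - gaussMoment b y Q := by
  have h : P - Q = P + C (-1) * Q := by simp [sub_eq_add_neg]
  rw [h, gaussMoment_add hb, gaussMoment_C_mul]
  ring

/-- Integration by parts: the difference of the two sides is the integral of the derivative of `P(z)
exp(-b z² + i y z)`. With `gaussMoment_one`, this is all that the evaluation of Gaussian integrals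
below relies on. -/
theorem gaussMoment_derivative {b : ℝ} (hb : 0 < b) (y : ℝ) (P : ℂ[X]) :
    gaussMoment b y (derivative P) =
      2 * b * gaussMoment b y (X * P) - Complex.I * y * gaussMoment b y P := by
  rw [← gaussMoment_C_mul, ← gaussMoment_C_mul, ← gaussMoment_sub hb, ← sub_eq_zero,
    ← gaussMoment_sub hb]
  refine integral_eq_zero_of_hasDerivAt_of_integrable
    (f := fun z : ℝ => P.eval (z : ℂ) * Complex.exp (-b * z ^ 2 + Complex.I * y * z))
    (fun z => ?_) (integrable_gaussMoment hb y _) (integrable_gaussMoment hb y P)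
  have h1 : HasDerivAt (fun z : ℂ => -b * z ^ 2 + Complex.I * y * z)
      (-b * (2 * z) + Complex.I * y) (z : ℂ) := by
    refine (((hasDerivAt_pow 2 (z : ℂ)).const_mul (-b : ℂ)).add
      ((hasDerivAt_id (z : ℂ)).const_mul (Complex.I * y))).congr_deriv ?_
    norm_num
  refine ((P.hasDerivAt (z : ℂ)).mul h1.cexp).comp_ofReal.congr_deriv ?_
  simp only [eval_sub, eval_mul, eval_C, eval_X]
  ring

theorem gaussMoment_one {b : ℝ} (hb : 0 < b) (y : ℝ) :
    gaussMoment b y 1 = (Real.sqrt (Real.pi / b) * Real.exp (-(y ^ 2 / (4 * b))) : ℝ) := by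
  have h := integral_cexp_quadratic (b := -b) (by simpa using hb) (Complex.I * y) 0
  simp only [add_zero] at h
  simp only [gaussMoment, eval_one, one_mul]
  rw [h]
  have h2 : (Real.pi / -(-b : ℂ)) ^ (1 / 2 : ℂ) = (Real.sqrt (Real.pi / b) : ℝ) := by
    rw [Real.sqrt_eq_rpow, Complex.ofReal_cpow (by have := Real.pi_pos; positivity)]
    simp
  rw [h2]
  push_cast
  congr 2
  rw [mul_pow, Complex.I_sq]
  have : (b : ℂ) ≠ 0 := by exact_mod_cast hb.ne'
  field_simp
  ring

/-! ### Orthonormality and Wigner functions of the one-dimensional Hermite functions -/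

/-- The Hermite polynomials with complex coefficients. -/
def hermitePolyC (k : ℕ) : ℂ[X] := (hermitePoly k).map Complex.ofRealHom

theorem eval_hermitePolyC (k : ℕ) (x : ℝ) :
    (hermitePolyC k).eval (x : ℂ) = ((hermitePoly k).eval x : ℝ) := by
  rw [hermitePolyC]
  exact eval_map_apply (f := Complex.ofRealHom) x

theorem hermitePolyC_zero : hermitePolyC 0 = 1 := by simp [hermitePolyC, hermitePoly]

theorem hermitePolyC_succ (k : ℕ) : hermitePolyC (k + 1) =
    C (hermiteScale : ℂ) * X * hermitePolyC k - C (k : ℂ) * hermitePolyC (k - 1) := by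
  simp [hermitePolyC, hermitePoly_succ]

theorem derivative_hermitePolyC (k : ℕ) :
    derivative (hermitePolyC k) = C (hermiteScale * k : ℂ) * hermitePolyC (k - 1) := by
  rw [hermitePolyC, derivative_map, derivative_hermitePoly]
  simp [hermitePolyC]

theorem hermiteScale_sq_complex : (hermiteScale : ℂ) ^ 2 = 4 * Real.pi := by
  exact_mod_cast hermiteScale_sq

/-- For the weight `e^{-2πz²}` the raising operator is adjoint to `c⁻¹ d/dz`, which lowers
`hermitePolyC l` with factor `l`. The term where the derivative falls on `hermitePolyC k` cancels
against the recurrence. -/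
theorem gaussMoment_hermite_succ (k l : ℕ) :
    gaussMoment (2 * Real.pi) 0 (hermitePolyC (k + 1) * hermitePolyC l) =
      l * gaussMoment (2 * Real.pi) 0 (hermitePolyC k * hermitePolyC (l - 1)) := by
  have hb : 0 < 2 * Real.pi := by have := Real.pi_pos; positivity
  have h := gaussMoment_derivative hb 0 (hermitePolyC k * hermitePolyC l)
  rw [derivative_mul, derivative_hermitePolyC, derivative_hermitePolyC, mul_assoc,
    mul_left_comm (hermitePolyC k), gaussMoment_add hb, gaussMoment_C_mul, gaussMoment_C_mul] at h
  rw [hermitePolyC_succ, sub_mul, gaussMoment_sub hb, mul_assoc, mul_assoc, mul_assoc,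
    gaussMoment_C_mul, gaussMoment_C_mul]
  have hc := hermiteScale_sq_complex
  have hc0 : (hermiteScale : ℂ) ≠ 0 := by exact_mod_cast hermiteScale_pos.ne'
  push_cast at h
  refine mul_left_cancel₀ hc0 ?_
  linear_combination (gaussMoment (2 * Real.pi) 0 (X * (hermitePolyC k * hermitePolyC l))) * hc - h

theorem gaussMoment_hermite (k l : ℕ) :
    gaussMoment (2 * Real.pi) 0 (hermitePolyC k * hermitePolyC l) =
      if k = l then (k.factorial * Real.sqrt (1 / 2) : ℂ) else 0 := by
  induction k generalizing l with
  | zero =>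
    cases l with
    | zero =>
      rw [hermitePolyC_zero, mul_one, gaussMoment_one (by have := Real.pi_pos; positivity)]
      have := Real.pi_pos
      have h : Real.pi / (2 * Real.pi) = 1 / 2 := by field_simp
      simp [h]
    | succ l => rw [mul_comm (hermitePolyC 0), gaussMoment_hermite_succ]; simp
  | succ k ih =>
    rw [gaussMoment_hermite_succ, ih]
    cases l with
    | zero => simp
    | succ l =>
      by_cases h : k = l
      · subst h; simp [Nat.factorial_succ, mul_assoc]
      · simp [h]

theorem rpow_quarter_mul_self : (2 : ℝ) ^ (1 / 4 : ℝ) * 2 ^ (1 / 4 : ℝ) = Real.sqrt 2 := by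
  rw [← Real.rpow_add two_pos, Real.sqrt_eq_rpow]
  norm_num

theorem integral_hermiteFun_mul (k l : ℕ) :
    ∫ x : ℝ, ((hermiteFun k x * hermiteFun l x : ℝ) : ℂ) = if k = l then 1 else 0 := by
  have h : ∀ x : ℝ, ((hermiteFun k x * hermiteFun l x : ℝ) : ℂ) =
      ((Real.sqrt 2 / (Real.sqrt k.factorial * Real.sqrt l.factorial) : ℝ) : ℂ) *
        ((hermitePolyC k * hermitePolyC l).eval (x : ℂ) *
          Complex.exp (-(2 * Real.pi : ℝ) * x ^ 2 + Complex.I * (0 : ℝ) * x)) := by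
    intro x
    rw [eval_mul, eval_hermitePolyC, eval_hermitePolyC, hermiteFun_eq_hermitePoly,
      hermiteFun_eq_hermitePoly, ← rpow_quarter_mul_self]
    have e : Complex.exp (-(2 * Real.pi : ℝ) * x ^ 2 + Complex.I * (0 : ℝ) * x) =
        (Real.exp (-(Real.pi * x ^ 2)) * Real.exp (-(Real.pi * x ^ 2)) : ℝ) := by
      rw [← Real.exp_add]
      push_cast
      congr 1
      ring
    rw [e]
    push_cast
    ring
  simp_rw [h]
  rw [integral_const_mul]
  change _ * gaussMoment (2 * Real.pi) 0 (hermitePolyC k * hermitePolyC l) = _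
  rw [gaussMoment_hermite]
  split_ifs with hkl
  · subst hkl
    rw [← Complex.ofReal_natCast, ← Complex.ofReal_mul, ← Complex.ofReal_mul]
    norm_cast
    rw [Real.mul_self_sqrt (by positivity)]
    have : (k.factorial : ℝ) ≠ 0 := by positivity
    field_simp
    simp
  · simp

/-- The coefficients of `exp (-s t + s A + t B)`, up to the factor `k! l!`. -/
def mixedHermite (A B : ℂ) : ℕ → ℕ → ℂ
  | 0, l => B ^ l
  | k + 1, l => A * mixedHermite A B k l - l * mixedHermite A B k (l - 1)

/-- These are the coefficients read off from the product of the series of `e^{-st}`, `e^{sA}` and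
`e^{tB}`; the induction on `k` is Pascal's rule. -/
theorem mixedHermite_eq_sum (A B : ℂ) (k l : ℕ) :
    mixedHermite A B k l = ∑ m ∈ Finset.range (k + 1),
      (-1) ^ m * (m.factorial * k.choose m * l.choose m : ℂ) * A ^ (k - m) * B ^ (l - m) := by
  induction k generalizing l with
  | zero => simp [mixedHermite]
  | succ k ih =>
    -- One more term is allowed, being zero because `k.choose (k + 1) = 0`; the sum for the `A` term
    -- then has the same range as the target and both can be split off at `m = 0`.
    have h0 : ∑ m ∈ Finset.range (k + 1),
        (-1 : ℂ) ^ m * (m.factorial * k.choose m * l.choose m : ℂ) * A ^ (k - m) * B ^ (l - m) =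
        ∑ m ∈ Finset.range (k + 2),
        (-1 : ℂ) ^ m * (m.factorial * k.choose m * l.choose m : ℂ) * A ^ (k - m) * B ^ (l - m) := by
      rw [Finset.sum_range_succ _ (k + 1)]
      simp
    rw [mixedHermite, ih, ih, h0, Finset.sum_range_succ' _ (k + 1), Finset.sum_range_succ' _ (k + 1),
      mul_add, add_sub_right_comm, Finset.mul_sum, Finset.mul_sum, ← Finset.sum_sub_distrib]
    congr 1
    · refine Finset.sum_congr rfl fun j hj => ?_
      have h1 : ((j + 1).factorial * l.choose (j + 1) : ℂ) = l * (j.factorial * (l - 1).choose j) := by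
        cases l with
        | zero => simp
        | succ l =>
          have := Nat.add_one_mul_choose_eq l j
          rw [Nat.factorial_succ, Nat.add_sub_cancel]
          norm_cast
          rw [mul_left_comm, this]
          ring
      have h2 : A * ((k.choose (j + 1) : ℂ) * A ^ (k - (j + 1))) = k.choose (j + 1) * A ^ (k - j) := by
        rcases Nat.lt_or_ge k (j + 1) with hlt | hge
        · simp [Nat.choose_eq_zero_of_lt hlt]
        · rw [show k - j = k - (j + 1) + 1 by omega, pow_succ]
          ring
      rw [Nat.choose_succ_succ, show k + 1 - (j + 1) = k - j by omega,
        show l - 1 - j = l - (j + 1) by omega]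
      push_cast at h1 ⊢
      linear_combination ((-1) ^ (j + 1) * ((j + 1).factorial * l.choose (j + 1) : ℂ) *
        B ^ (l - (j + 1))) * h2 - (-1) ^ (j + 1) * B ^ (l - (j + 1)) * k.choose j * A ^ (k - j) * h1
    · simp [pow_succ]
      ring

/-- Every monomial is `A^(k-m) B^(l-m)`, so the scaling produces `c^(l-k)` throughout; the powers
are placed on both sides to avoid a negative exponent. -/
theorem mixedHermite_homogeneous {c : ℂ} (hc : c ≠ 0) (A B : ℂ) (k l : ℕ) :
    mixedHermite (c⁻¹ * A) (c * B) k l * c ^ k = c ^ l * mixedHermite A B k l := by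
  induction k generalizing l with
  | zero => simp [mixedHermite, mul_pow]
  | succ k ih =>
    rw [mixedHermite, mixedHermite]
    have h1 := ih l
    have h2 := ih (l - 1)
    cases l with
    | zero =>
      rw [pow_zero, one_mul] at h1
      rw [Nat.cast_zero, zero_mul, zero_mul, sub_zero, sub_zero, ← h1, pow_succ]
      field_simp
    | succ l =>
      simp only [Nat.add_sub_cancel] at h2 ⊢
      have : (c⁻¹ * A * mixedHermite (c⁻¹ * A) (c * B) k (l + 1) -
          ((l + 1 : ℕ) : ℂ) * mixedHermite (c⁻¹ * A) (c * B) k l) * c ^ (k + 1) =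
          A * (mixedHermite (c⁻¹ * A) (c * B) k (l + 1) * c ^ k) -
          ((l + 1 : ℕ) : ℂ) * c * (mixedHermite (c⁻¹ * A) (c * B) k l * c ^ k) := by
        field_simp
        ring
      rw [this, h1, h2]
      ring

/-- Hermite polynomials in the shifted variables `x + z / 2` and `x - z / 2`. -/
def shiftedHermite (x : ℝ) (k l : ℕ) : ℂ[X] :=
  (hermitePolyC k).comp (C (x : ℂ) + C (1 / 2) * X) *
    (hermitePolyC l).comp (C (x : ℂ) - C (1 / 2) * X)

/-- Raising `k` through the three-term recurrence creates a factor `X`, which integration by parts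
trades for lowered indices and a multiple of `ξ`. As `c² = 4π`, the terms lowering `k` cancel, and
what is left is exactly the recursion defining `mixedHermite`. The base case `k = 0` is the same
computation in `l`. -/
theorem gaussMoment_shiftedHermite (x ξ : ℝ) (k l : ℕ) :
    gaussMoment (Real.pi / 2) (-(2 * Real.pi * ξ)) (shiftedHermite x k l) =
      (Real.sqrt 2 * Real.exp (-(2 * Real.pi * ξ ^ 2)) : ℝ) *
        mixedHermite (hermiteScale * (x - Complex.I * ξ)) (hermiteScale * (x + Complex.I * ξ))
          k l := by
  have hb : 0 < Real.pi / 2 := by have := Real.pi_pos; positivity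
  have hpi : (Real.pi : ℂ) ≠ 0 := by exact_mod_cast Real.pi_ne_zero
  have hc := hermiteScale_sq_complex
  have hder : ∀ k l, derivative (shiftedHermite x k l) =
      C (hermiteScale * k / 2 : ℂ) * shiftedHermite x (k - 1) l -
      C (hermiteScale * l / 2 : ℂ) * shiftedHermite x k (l - 1) := by
    intro k l
    simp only [shiftedHermite, derivative_mul, derivative_comp, derivative_hermitePolyC,
      derivative_add, derivative_sub, derivative_C, derivative_X, mul_comp, C_comp, zero_mul,
      mul_one, zero_add, zero_sub, div_eq_mul_inv, C_mul, one_mul]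
    ring
  have hstep : ∀ k l, Real.pi * gaussMoment (Real.pi / 2) (-(2 * Real.pi * ξ))
        (X * shiftedHermite x k l) =
      hermiteScale * k / 2 * gaussMoment (Real.pi / 2) (-(2 * Real.pi * ξ))
        (shiftedHermite x (k - 1) l) -
      hermiteScale * l / 2 * gaussMoment (Real.pi / 2) (-(2 * Real.pi * ξ))
        (shiftedHermite x k (l - 1)) - 2 * Real.pi * Complex.I * ξ *
        gaussMoment (Real.pi / 2) (-(2 * Real.pi * ξ)) (shiftedHermite x k l) := by
    intro k l
    have h := gaussMoment_derivative hb (-(2 * Real.pi * ξ)) (shiftedHermite x k l)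
    rw [hder, gaussMoment_sub hb, gaussMoment_C_mul, gaussMoment_C_mul] at h
    push_cast at h ⊢
    linear_combination -h
  induction k generalizing l with
  | zero =>
    rw [mixedHermite]
    induction l with
    | zero =>
      have : shiftedHermite x 0 0 = 1 := by simp [shiftedHermite, hermitePolyC_zero]
      rw [this, gaussMoment_one hb, pow_zero, mul_one]
      have := Real.pi_pos
      congr 3
      · field_simp
      · field_simp; ring
    | succ l ih =>
      have e : shiftedHermite x 0 (l + 1) = C (hermiteScale * x : ℂ) * shiftedHermite x 0 l -
          C (hermiteScale / 2 : ℂ) * (X * shiftedHermite x 0 l) -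
          C (l : ℂ) * shiftedHermite x 0 (l - 1) := by
        simp only [shiftedHermite, hermitePolyC_succ, hermitePolyC_zero, sub_comp, mul_comp,
          C_comp, X_comp, one_comp, div_eq_mul_inv, C_mul, one_mul]
        ring
      have h := hstep 0 l
      rw [e, gaussMoment_sub hb, gaussMoment_sub hb, gaussMoment_C_mul, gaussMoment_C_mul,
        gaussMoment_C_mul, pow_succ _ l, ← mul_assoc, ← ih]
      refine mul_left_cancel₀ hpi ?_
      push_cast at h
      linear_combination (-hermiteScale / 2 : ℂ) * h +
        (l / 4 * gaussMoment (Real.pi / 2) (-(2 * Real.pi * ξ)) (shiftedHermite x 0 (l - 1))) * hc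
  | succ k ih =>
    have e : shiftedHermite x (k + 1) l = C (hermiteScale * x : ℂ) * shiftedHermite x k l +
        C (hermiteScale / 2 : ℂ) * (X * shiftedHermite x k l) -
        C (k : ℂ) * shiftedHermite x (k - 1) l := by
      simp only [shiftedHermite, hermitePolyC_succ, sub_comp, mul_comp, C_comp, X_comp,
        div_eq_mul_inv, C_mul, one_mul]
      ring
    have h := hstep k l
    rw [e, gaussMoment_sub hb, gaussMoment_add hb, gaussMoment_C_mul, gaussMoment_C_mul,
      gaussMoment_C_mul, mixedHermite, mul_sub, mul_left_comm, ← ih, mul_left_comm, ← ih]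
    refine mul_left_cancel₀ hpi ?_
    linear_combination (hermiteScale / 2 : ℂ) * h +
      (k / 4 * gaussMoment (Real.pi / 2) (-(2 * Real.pi * ξ)) (shiftedHermite x (k - 1) l) -
        l / 4 * gaussMoment (Real.pi / 2) (-(2 * Real.pi * ξ)) (shiftedHermite x k (l - 1))) * hc

/-- The Wigner function of a pair of one-dimensional Hermite functions, at `ζ = x + i ξ`. -/
def hermiteWigner (k l : ℕ) (ζ : ℂ) : ℂ :=
  (2 * Real.exp (-(2 * Real.pi * ‖ζ‖ ^ 2)) / (Real.sqrt k.factorial * Real.sqrt l.factorial) : ℝ) *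
    mixedHermite (hermiteScale * (starRingEnd ℂ) ζ) (hermiteScale * ζ) k l

theorem integral_wigner_hermiteFun (k l : ℕ) (ζ : ℂ) :
    ∫ z : ℝ, Complex.exp (-(2 * Real.pi * (z * ζ.im) : ℝ) * Complex.I) *
      ((hermiteFun k (ζ.re + 1 / 2 * z) : ℂ) * (hermiteFun l (ζ.re - 1 / 2 * z) : ℂ)) =
      hermiteWigner k l ζ := by
  set x := ζ.re with hx
  set ξ := ζ.im with hξ
  have h : ∀ z : ℝ, Complex.exp (-(2 * Real.pi * (z * ξ) : ℝ) * Complex.I) *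
      ((hermiteFun k (x + 1 / 2 * z) : ℂ) * (hermiteFun l (x - 1 / 2 * z) : ℂ)) =
      ((Real.sqrt 2 / (Real.sqrt k.factorial * Real.sqrt l.factorial) *
        Real.exp (-(2 * Real.pi * x ^ 2)) : ℝ) : ℂ) *
        ((shiftedHermite x k l).eval (z : ℂ) *
          Complex.exp (-(Real.pi / 2 : ℝ) * z ^ 2 +
            Complex.I * (-(2 * Real.pi * ξ) : ℝ) * z)) := by
    intro z
    have e1 : (hermitePolyC k).eval (x + 1 / 2 * z : ℂ) =
        ((hermitePoly k).eval (x + 1 / 2 * z) : ℝ) := by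
      rw [← eval_hermitePolyC]; push_cast; rfl
    have e2 : (hermitePolyC l).eval (x - 1 / 2 * z : ℂ) =
        ((hermitePoly l).eval (x - 1 / 2 * z) : ℝ) := by
      rw [← eval_hermitePolyC]; push_cast; rfl
    rw [shiftedHermite, eval_mul, eval_comp, eval_comp, eval_add, eval_sub, eval_mul, eval_C,
      eval_C, eval_X, e1, e2, hermiteFun_eq_hermitePoly,
      hermiteFun_eq_hermitePoly, ← rpow_quarter_mul_self]
    -- Parallelogram identity: `(x + z/2)² + (x - z/2)² = 2x² + z²/2`, whence the Gaussian parameter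
    -- `π/2`.
    have e : Complex.exp (-(2 * Real.pi * (z * ξ) : ℝ) * Complex.I) *
        ((Real.exp (-(Real.pi * (x + 1 / 2 * z) ^ 2)) : ℝ) *
          (Real.exp (-(Real.pi * (x - 1 / 2 * z) ^ 2)) : ℝ)) =
        (Real.exp (-(2 * Real.pi * x ^ 2)) : ℝ) * Complex.exp (-(Real.pi / 2 : ℝ) * z ^ 2 +
            Complex.I * (-(2 * Real.pi * ξ) : ℝ) * z) := by
      push_cast
      rw [← Complex.exp_add, ← Complex.exp_add, ← Complex.exp_add]
      congr 1
      ring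
    push_cast at e ⊢
    linear_combination ((2 : ℝ) ^ (1 / 4 : ℝ) : ℝ) * ((2 : ℝ) ^ (1 / 4 : ℝ) : ℝ) /
      ((Real.sqrt k.factorial : ℂ) * (Real.sqrt l.factorial : ℂ)) *
      ((hermitePoly k).eval (x + 1 / 2 * z) : ℝ) * ((hermitePoly l).eval (x - 1 / 2 * z) : ℝ) * e
  simp_rw [h]
  rw [integral_const_mul]
  change _ * gaussMoment (Real.pi / 2) (-(2 * Real.pi * ξ)) (shiftedHermite x k l) = _
  rw [gaussMoment_shiftedHermite, hermiteWigner]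
  have e3 : (starRingEnd ℂ) ζ = x - Complex.I * ξ := by
    apply Complex.ext <;> simp [hx, hξ]
  have e4 : (x + Complex.I * ξ : ℂ) = ζ := by
    apply Complex.ext <;> simp [hx, hξ]
  rw [← e3, e4, ← mul_assoc, ← Complex.ofReal_mul]
  congr 2
  have e5 : ‖ζ‖ ^ 2 = x ^ 2 + ξ ^ 2 := by
    rw [← Complex.normSq_eq_norm_sq, Complex.normSq_apply]; ring
  rw [e5, mul_add, neg_add, Real.exp_add]
  have h2 : Real.sqrt 2 * Real.sqrt 2 = 2 := Real.mul_self_sqrt (by norm_num)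
  linear_combination (Real.exp (-(2 * Real.pi * x ^ 2)) * Real.exp (-(2 * Real.pi * ξ ^ 2)) /
    (Real.sqrt k.factorial * Real.sqrt l.factorial)) * h2

/-- Rotation covariance, the source of the vanishing of off-diagonal entries: the Gaussian factor
depends on `‖ζ‖` only, and the two arguments of `mixedHermite` scale by `c⁻¹` and `c`. -/
theorem hermiteWigner_mul_circle (k l : ℕ) (c : Circle) (ζ : ℂ) :
    hermiteWigner k l (c * ζ) * (c : ℂ) ^ k = (c : ℂ) ^ l * hermiteWigner k l ζ := by
  have hc : (c : ℂ) ≠ 0 := Circle.coe_ne_zero c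
  have h := mixedHermite_homogeneous hc (hermiteScale * (starRingEnd ℂ) ζ) (hermiteScale * ζ) k l
  have e1 : (hermiteScale : ℂ) * (starRingEnd ℂ) (c * ζ) =
      (c : ℂ)⁻¹ * (hermiteScale * (starRingEnd ℂ) ζ) := by
    rw [map_mul, ← Circle.coe_inv_eq_conj, Circle.coe_inv]
    ring
  rw [hermiteWigner, hermiteWigner, norm_mul, Circle.norm_coe, one_mul, e1,
    mul_left_comm (hermiteScale : ℂ) (c : ℂ) ζ, mul_assoc, h]
  ring

/-- For `k = l` the sum in `mixedHermite_eq_sum` is a polynomial in `|cζ|² = 4π|ζ|²` with `c =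
hermiteScale`; the reflection `m ↦ k - m` identifies it with `k! (-1)ᵏ Lₖ`. The bracketing exhibits
`t = 2 (π‖ζ‖²)`, so that the right side is literally twice `coeffFactor k t`. -/
theorem hermiteWigner_self (k : ℕ) (ζ : ℂ) :
    hermiteWigner k k ζ = ((2 * (Real.exp (-(2 * (Real.pi * ‖ζ‖ ^ 2))) *
      ((-1) ^ k * laguerre k (2 * (2 * (Real.pi * ‖ζ‖ ^ 2))))) : ℝ) : ℂ) := by
  have hf : (k.factorial : ℝ) ≠ 0 := by positivity
  have hX : (hermiteScale * (starRingEnd ℂ) ζ) * (hermiteScale * ζ) =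
      ((2 * (2 * (Real.pi * ‖ζ‖ ^ 2)) : ℝ) : ℂ) := by
    have h1 := Complex.conj_mul' ζ
    have h2 := hermiteScale_sq_complex
    push_cast
    linear_combination (hermiteScale : ℂ) ^ 2 * h1 + (‖ζ‖ : ℂ) ^ 2 * h2
  have hM : mixedHermite (hermiteScale * (starRingEnd ℂ) ζ) (hermiteScale * ζ) k k =
      ((k.factorial * ((-1) ^ k * laguerre k (2 * (2 * (Real.pi * ‖ζ‖ ^ 2)))) : ℝ) : ℂ) := by
    rw [mixedHermite_eq_sum, laguerre, ← Finset.sum_range_reflect, Finset.mul_sum, Finset.mul_sum,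
      Complex.ofReal_sum]
    refine Finset.sum_congr rfl fun m hm => ?_
    have hm : m ≤ k := Nat.lt_succ_iff.1 (Finset.mem_range.1 hm)
    rw [show k + 1 - 1 - m = k - m by omega, Nat.choose_symm hm, show k - (k - m) = m by omega,
      mul_assoc, ← mul_pow, hX]
    push_cast
    have h1 : (k.choose m * m.factorial * (k - m).factorial : ℂ) = k.factorial := by
      exact_mod_cast Nat.choose_mul_factorial_mul_factorial hm
    have h2 : ((-1 : ℂ) ^ (k - m)) = (-1) ^ k * (-1) ^ m := by
      have : (-1 : ℂ) ^ m * (-1) ^ m = 1 := by rw [← mul_pow]; simp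
      conv_rhs => rw [← Nat.sub_add_cancel hm, pow_add, mul_assoc, this, mul_one]
    have h3 : (m.factorial : ℂ) ≠ 0 := by exact_mod_cast m.factorial_ne_zero
    rw [h2, ← h1]
    field_simp
  rw [hermiteWigner, hM, ← Complex.ofReal_mul, Real.mul_self_sqrt (by positivity)]
  congr 1
  field_simp

end

/-! ### The Wigner function on `L²` and the Weyl quantization of a set of finite measure -/

theorem map_affine_volume {n : ℕ} (x : EuclideanSpace ℝ (Fin n)) {r : ℝ} (hr : r ≠ 0) :
    Measure.map (fun z : EuclideanSpace ℝ (Fin n) => x + r • z) volume =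
      ENNReal.ofReal |(r ^ n)⁻¹| • volume := by
  have h1 : Measure.map (fun z : EuclideanSpace ℝ (Fin n) => x + r • z) volume =
      Measure.map (fun z => x + z) (Measure.map (fun z => r • z) volume) := by
    rw [Measure.map_map (by fun_prop) (by fun_prop)]
    rfl
  rw [h1, Measure.map_addHaar_smul _ hr, Measure.map_smul, map_add_left_eq_self]
  simp

theorem quasiMeasurePreserving_affine {n : ℕ} (x : EuclideanSpace ℝ (Fin n)) {r : ℝ}
    (hr : r ≠ 0) : Measure.QuasiMeasurePreserving (fun z => x + r • z) := by
  refine ⟨by fun_prop, ?_⟩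
  rw [map_affine_volume x hr]
  exact Measure.smul_absolutelyContinuous

theorem eLpNorm_comp_affine {n : ℕ} {f : EuclideanSpace ℝ (Fin n) → ℂ}
    (hf : AEStronglyMeasurable f) (x : EuclideanSpace ℝ (Fin n)) {r : ℝ} (hr : r ≠ 0) :
    eLpNorm (fun z => f (x + r • z)) 2 =
      ENNReal.ofReal |(r ^ n)⁻¹| ^ (1 / (2 : ENNReal)).toReal * eLpNorm f 2 := by
  have h := eLpNorm_map_measure (p := 2)
    (hf.mono_ac (quasiMeasurePreserving_affine x hr).absolutelyContinuous)
    (quasiMeasurePreserving_affine x hr).aemeasurable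
  rw [map_affine_volume x hr, eLpNorm_smul_measure_of_ne_top ENNReal.ofNat_ne_top] at h
  exact h.symm

theorem memLp_comp_affine {n : ℕ} {f : EuclideanSpace ℝ (Fin n) → ℂ}
    (hf : MemLp f 2) (x : EuclideanSpace ℝ (Fin n)) {r : ℝ} (hr : r ≠ 0) :
    MemLp (fun z => f (x + r • z)) 2 := by
  refine ⟨hf.1.comp_quasiMeasurePreserving (quasiMeasurePreserving_affine x hr), ?_⟩
  rw [eLpNorm_comp_affine hf.1 x hr]
  exact ENNReal.mul_lt_top
    (ENNReal.rpow_lt_top_of_nonneg ENNReal.toReal_nonneg ENNReal.ofReal_ne_top) hf.2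

theorem sub_half_smul {n : ℕ} (x z : EuclideanSpace ℝ (Fin n)) :
    x - (1 / 2 : ℝ) • z = x + (-(1 / 2) : ℝ) • z := by
  rw [neg_smul, sub_eq_add_neg]

theorem norm_exp_neg_ofReal_mul_I (t : ℝ) : ‖Complex.exp (-(t : ℝ) * Complex.I)‖ = 1 := by
  rw [← Complex.ofReal_neg, Complex.norm_exp_ofReal_mul_I]

/-- The equality holds at every `p`, not just almost everywhere, since the affine maps `z ↦ x ± z/2`
pull null sets back to null sets. Hence `wigner` is well defined pointwise on `L²` classes. -/
theorem wigner_congr {n : ℕ} {f f' g g' : EuclideanSpace ℝ (Fin n) → ℂ}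
    (hf : f =ᵐ[volume] f') (hg : g =ᵐ[volume] g') (p : Phase n) :
    wigner f g p = wigner f' g' p := by
  refine integral_congr_ae ?_
  filter_upwards [(quasiMeasurePreserving_affine p.1 (r := 1 / 2) (by norm_num)).ae hf,
    (quasiMeasurePreserving_affine p.1 (r := -(1 / 2)) (by norm_num)).ae hg] with z h1 h2
  rw [sub_half_smul, h1, h2]

theorem memLp_wigner_left {n : ℕ} {f : EuclideanSpace ℝ (Fin n) → ℂ} (hf : MemLp f 2)
    (p : Phase n) : MemLp (fun z : EuclideanSpace ℝ (Fin n) =>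
      Complex.exp (-(2 * Real.pi * inner ℝ z p.2 : ℝ) * Complex.I) *
        f (p.1 + (1 / 2 : ℝ) • z)) 2 := by
  have h := memLp_comp_affine hf p.1 (r := 1 / 2) (by norm_num)
  refine h.of_le (AEStronglyMeasurable.mul (by fun_prop) h.1)
    (Filter.Eventually.of_forall fun z => ?_)
  rw [norm_mul, norm_exp_neg_ofReal_mul_I, one_mul]

theorem memLp_wigner_right {n : ℕ} {g : EuclideanSpace ℝ (Fin n) → ℂ} (hg : MemLp g 2)
    (p : Phase n) : MemLp (fun z : EuclideanSpace ℝ (Fin n) =>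
      (starRingEnd ℂ) (g (p.1 - (1 / 2 : ℝ) • z))) 2 := by
  simp only [sub_half_smul]
  exact (memLp_comp_affine hg p.1 (r := -(1 / 2)) (by norm_num)).star

theorem integrable_wigner_integrand {n : ℕ} {f g : EuclideanSpace ℝ (Fin n) → ℂ}
    (hf : MemLp f 2) (hg : MemLp g 2) (p : Phase n) :
    Integrable (fun z : EuclideanSpace ℝ (Fin n) =>
      Complex.exp (-(2 * Real.pi * inner ℝ z p.2 : ℝ) * Complex.I) *
      (f (p.1 + (1 / 2 : ℝ) • z) * (starRingEnd ℂ) (g (p.1 - (1 / 2 : ℝ) • z)))) := by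
  refine ((memLp_wigner_left hf p).integrable_mul (memLp_wigner_right hg p)).congr
    (Filter.Eventually.of_forall fun z => ?_)
  simp only [Pi.mul_apply, mul_assoc]

/-- Cauchy–Schwarz in `z`. The constant is the product of the `L²` scaling factors of `z ↦ x + z/2`
and `z ↦ x - z/2`, which do not depend on `p`. -/
theorem exists_norm_wigner_le (n : ℕ) : ∃ c : ℝ, 0 ≤ c ∧
    ∀ {f g : EuclideanSpace ℝ (Fin n) → ℂ}, MemLp f 2 → MemLp g 2 → ∀ p : Phase n,
      ‖wigner f g p‖ ≤ c * (eLpNorm f 2).toReal * (eLpNorm g 2).toReal := by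
  refine ⟨(ENNReal.ofReal |((1 / 2 : ℝ) ^ n)⁻¹| ^ (1 / (2 : ENNReal)).toReal).toReal *
    (ENNReal.ofReal |((-(1 / 2) : ℝ) ^ n)⁻¹| ^ (1 / (2 : ENNReal)).toReal).toReal,
    by positivity, fun {f g} hf hg p => ?_⟩
  have hF := memLp_wigner_left hf p
  have hG := memLp_wigner_right hg p
  have e1 : eLpNorm (fun z : EuclideanSpace ℝ (Fin n) =>
      Complex.exp (-(2 * Real.pi * inner ℝ z p.2 : ℝ) * Complex.I) *
        f (p.1 + (1 / 2 : ℝ) • z)) 2 =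
      ENNReal.ofReal |((1 / 2 : ℝ) ^ n)⁻¹| ^ (1 / (2 : ENNReal)).toReal * eLpNorm f 2 := by
    rw [← eLpNorm_comp_affine hf.1 p.1 (by norm_num)]
    refine eLpNorm_congr_norm_ae (Filter.Eventually.of_forall fun z => ?_)
    rw [norm_mul, norm_exp_neg_ofReal_mul_I, one_mul]
  have e2 : eLpNorm (fun z : EuclideanSpace ℝ (Fin n) =>
      (starRingEnd ℂ) (g (p.1 - (1 / 2 : ℝ) • z))) 2 =
      ENNReal.ofReal |((-(1 / 2) : ℝ) ^ n)⁻¹| ^ (1 / (2 : ENNReal)).toReal * eLpNorm g 2 := by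
    rw [← eLpNorm_comp_affine hg.1 p.1 (by norm_num)]
    refine eLpNorm_congr_norm_ae (Filter.Eventually.of_forall fun z => ?_)
    rw [RCLike.norm_conj, sub_half_smul]
  have h1 := eLpNorm_smul_le_mul_eLpNorm (p := 2) (q := 2) (r := 1) hG.1 hF.1
  have h2 : ‖wigner f g p‖ₑ ≤ _ := (enorm_integral_le_lintegral_enorm _).trans
    (le_of_eq (eLpNorm_one_eq_lintegral_enorm
      (f := fun z : EuclideanSpace ℝ (Fin n) =>
        Complex.exp (-(2 * Real.pi * inner ℝ z p.2 : ℝ) * Complex.I) *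
        (f (p.1 + (1 / 2 : ℝ) • z) * (starRingEnd ℂ) (g (p.1 - (1 / 2 : ℝ) • z))))).symm)
  have h3 : (fun z : EuclideanSpace ℝ (Fin n) =>
        Complex.exp (-(2 * Real.pi * inner ℝ z p.2 : ℝ) * Complex.I) *
        (f (p.1 + (1 / 2 : ℝ) • z) * (starRingEnd ℂ) (g (p.1 - (1 / 2 : ℝ) • z)))) =
      (fun z : EuclideanSpace ℝ (Fin n) =>
        Complex.exp (-(2 * Real.pi * inner ℝ z p.2 : ℝ) * Complex.I) *
        f (p.1 + (1 / 2 : ℝ) • z)) • fun z => (starRingEnd ℂ) (g (p.1 - (1 / 2 : ℝ) • z)) := by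
    funext z
    simp only [Pi.smul_apply', smul_eq_mul, mul_assoc]
  rw [h3] at h2
  have h4 := ENNReal.toReal_mono (ENNReal.mul_lt_top hF.2 hG.2).ne (h2.trans h1)
  rw [toReal_enorm, e1, e2] at h4
  refine h4.trans (le_of_eq ?_)
  simp only [ENNReal.toReal_mul]
  ring

theorem stronglyMeasurable_wigner {n : ℕ} {f g : EuclideanSpace ℝ (Fin n) → ℂ}
    (hf : StronglyMeasurable f) (hg : StronglyMeasurable g) : StronglyMeasurable (wigner f g) := by
  refine StronglyMeasurable.integral_prod_right (ν := (volume : Measure (EuclideanSpace ℝ (Fin n))))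
    (f := fun (p : Phase n) (z : EuclideanSpace ℝ (Fin n)) =>
      Complex.exp (-(2 * Real.pi * inner ℝ z p.2 : ℝ) * Complex.I) *
      (f (p.1 + (1 / 2 : ℝ) • z) * (starRingEnd ℂ) (g (p.1 - (1 / 2 : ℝ) • z)))) ?_
  refine StronglyMeasurable.mul (Continuous.stronglyMeasurable (by fun_prop)) ?_
  refine StronglyMeasurable.mul (hf.comp_measurable (by fun_prop)) ?_
  exact (hg.comp_measurable (g := fun q : Phase n × EuclideanSpace ℝ (Fin n) =>
    q.1.1 - (1 / 2 : ℝ) • q.2) (by fun_prop)).star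

theorem wigner_add_left {n : ℕ} {f f' g : EuclideanSpace ℝ (Fin n) → ℂ} (hf : MemLp f 2)
    (hf' : MemLp f' 2) (hg : MemLp g 2) (p : Phase n) :
    wigner (f + f') g p = wigner f g p + wigner f' g p := by
  rw [wigner, wigner, wigner, ← integral_add (integrable_wigner_integrand hf hg p)
    (integrable_wigner_integrand hf' hg p)]
  simp only [Pi.add_apply, add_mul, mul_add]

theorem wigner_add_right {n : ℕ} {f g g' : EuclideanSpace ℝ (Fin n) → ℂ} (hf : MemLp f 2)
    (hg : MemLp g 2) (hg' : MemLp g' 2) (p : Phase n) :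
    wigner f (g + g') p = wigner f g p + wigner f g' p := by
  rw [wigner, wigner, wigner, ← integral_add (integrable_wigner_integrand hf hg p)
    (integrable_wigner_integrand hf hg' p)]
  simp only [Pi.add_apply, map_add, mul_add]

theorem wigner_smul_left {n : ℕ} (c : ℂ) (f g : EuclideanSpace ℝ (Fin n) → ℂ) (p : Phase n) :
    wigner (c • f) g p = c * wigner f g p := by
  rw [wigner, wigner, ← integral_const_mul]
  congr 1
  funext z
  simp only [Pi.smul_apply, smul_eq_mul]
  ring

theorem wigner_smul_right {n : ℕ} (c : ℂ) (f g : EuclideanSpace ℝ (Fin n) → ℂ) (p : Phase n) :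
    wigner f (c • g) p = (starRingEnd ℂ) c * wigner f g p := by
  rw [wigner, wigner, ← integral_const_mul]
  congr 1
  funext z
  simp only [Pi.smul_apply, smul_eq_mul, map_mul]
  ring

theorem exists_norm_wigner_L2_le (n : ℕ) : ∃ c : ℝ, 0 ≤ c ∧
    ∀ (u v : L2 n) (p : Phase n), ‖wigner u v p‖ ≤ c * ‖u‖ * ‖v‖ := by
  obtain ⟨c, hc, h⟩ := exists_norm_wigner_le n
  exact ⟨c, hc, fun u v p => h (Lp.memLp u) (Lp.memLp v) p⟩

theorem integrableOn_wigner {n : ℕ} {S : Set (Phase n)} (hS : volume S ≠ ⊤) (u v : L2 n) :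
    IntegrableOn (wigner u v) S := by
  obtain ⟨c, -, h⟩ := exists_norm_wigner_L2_le n
  exact Measure.integrableOn_of_bounded hS
    (stronglyMeasurable_wigner (Lp.stronglyMeasurable u)
      (Lp.stronglyMeasurable v)).aestronglyMeasurable (Filter.Eventually.of_forall (h u v))

/-- A form bounded by the uniform Wigner bound times `volume S` is represented by an operator, by
Riesz. The formula is obtained for all of `L²`, so it can later be applied to Hermite functions
without showing that they are Schwartz. -/
theorem exists_weylOperator {n : ℕ} {S : Set (Phase n)} (hS : volume S ≠ ⊤) :
    ∃ A : L2 n →L[ℂ] L2 n, ∀ u v : L2 n, inner ℂ v (A u) = ∫ p in S, wigner u v p := by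
  obtain ⟨c, hc, hbound⟩ := exists_norm_wigner_L2_le n
  let B : L2 n →ₛₗ[starRingEnd ℂ] L2 n →ₗ[ℂ] ℂ :=
    LinearMap.mk₂'ₛₗ (starRingEnd ℂ) (RingHom.id ℂ) (fun v u => ∫ p in S, wigner u v p)
      (fun v v' u => by
        rw [← integral_add (integrableOn_wigner hS u v) (integrableOn_wigner hS u v')]
        refine integral_congr_ae (Filter.Eventually.of_forall fun p => ?_)
        simp only
        rw [← wigner_add_right (Lp.memLp u) (Lp.memLp v) (Lp.memLp v')]
        exact wigner_congr (Filter.EventuallyEq.refl _ _) (Lp.coeFn_add v v') p)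
      (fun a v u => by
        rw [smul_eq_mul, ← integral_const_mul]
        refine integral_congr_ae (Filter.Eventually.of_forall fun p => ?_)
        simp only
        rw [← wigner_smul_right]
        exact wigner_congr (Filter.EventuallyEq.refl _ _) (Lp.coeFn_smul a v) p)
      (fun v u u' => by
        rw [← integral_add (integrableOn_wigner hS u v) (integrableOn_wigner hS u' v)]
        refine integral_congr_ae (Filter.Eventually.of_forall fun p => ?_)
        simp only
        rw [← wigner_add_left (Lp.memLp u) (Lp.memLp u') (Lp.memLp v)]
        exact wigner_congr (Lp.coeFn_add u u') (Filter.EventuallyEq.refl _ _) p)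
      (fun a v u => by
        rw [RingHom.id_apply, smul_eq_mul, ← integral_const_mul]
        refine integral_congr_ae (Filter.Eventually.of_forall fun p => ?_)
        simp only
        rw [← wigner_smul_left]
        exact wigner_congr (Lp.coeFn_smul a u) (Filter.EventuallyEq.refl _ _) p)
  have hB : ∀ v u : L2 n, ‖B v u‖ ≤ c * (volume S).toReal * ‖v‖ * ‖u‖ := by
    intro v u
    refine (norm_setIntegral_le_of_norm_le_const (lt_top_iff_ne_top.2 hS)
      (fun p _ => hbound u v p)).trans (le_of_eq ?_)
    rw [Measure.real]
    ring
  let B' : L2 n →L⋆[ℂ] L2 n →L[ℂ] ℂ := B.mkContinuous₂ (c * (volume S).toReal) hB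
  -- The representing map acts on the conjugate-linear variable `v`; its adjoint acts on `u`.
  refine ⟨(InnerProductSpace.continuousLinearMapOfBilin B').adjoint, fun u v => ?_⟩
  rw [ContinuousLinearMap.adjoint_inner_right, InnerProductSpace.continuousLinearMapOfBilin_apply]
  rfl

theorem indicator_one_mul_wigner {n : ℕ} (S : Set (Phase n))
    (u v : EuclideanSpace ℝ (Fin n) → ℂ) :
    (fun p : Phase n => S.indicator (fun _ => (1 : ℂ)) p * wigner u v p) =
      S.indicator (wigner u v) := by
  funext p
  by_cases hp : p ∈ S <;> simp [hp]

theorem wigner_toLp {n : ℕ} (u v : SchwartzMap (EuclideanSpace ℝ (Fin n)) ℂ) (p : Phase n) :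
    wigner (u.toLp 2 : L2 n) (v.toLp 2 : L2 n) p = wigner u v p :=
  wigner_congr (SchwartzMap.coeFn_toLp u 2 volume) (SchwartzMap.coeFn_toLp v 2 volume) p

theorem isWeylQuantization_indicator {n : ℕ} {S : Set (Phase n)} (hSm : MeasurableSet S)
    (hS : volume S ≠ ⊤) {A : L2 n →L[ℂ] L2 n}
    (hA : ∀ u v : L2 n, inner ℂ v (A u) = ∫ p in S, wigner u v p) :
    IsWeylQuantization (S.indicator fun _ => (1 : ℂ)) A := by
  intro u v
  have h : wigner (u.toLp 2 : L2 n) (v.toLp 2 : L2 n) = wigner u v := funext (wigner_toLp u v)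
  rw [indicator_one_mul_wigner, integral_indicator hSm, integrable_indicator_iff hSm, hA, h]
  exact ⟨h ▸ integrableOn_wigner hS _ _, rfl⟩

theorem IsWeylQuantization.unique {n : ℕ} {b : Phase n → ℂ} {A A' : L2 n →L[ℂ] L2 n}
    (hA : IsWeylQuantization b A) (hA' : IsWeylQuantization b A') : A = A' := by
  have hd : DenseRange fun u : SchwartzMap (EuclideanSpace ℝ (Fin n)) ℂ => (u.toLp 2 : L2 n) :=
    SchwartzMap.denseRange_toLpCLM ENNReal.ofNat_ne_top
  have h : ∀ u : SchwartzMap (EuclideanSpace ℝ (Fin n)) ℂ, A (u.toLp 2) = A' (u.toLp 2) := by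
    intro u
    refine ext_inner_left ℂ fun w => ?_
    have h1 : Continuous fun v : L2 n => (inner ℂ v (A (u.toLp 2)) : ℂ) := by fun_prop
    have h1' : Continuous fun v : L2 n => (inner ℂ v (A' (u.toLp 2)) : ℂ) := by fun_prop
    exact congrFun (hd.equalizer h1 h1' (funext fun v => (hA u v).2.trans (hA' u v).2.symm)) w
  exact ContinuousLinearMap.coeFn_injective
    (hd.equalizer A.continuous A'.continuous (funext h))

/-! ### Measurability and finite volume of the ellipsoid -/

theorem measurableSet_ellipsoid {n : ℕ} (a : Fin n → ℝ) : MeasurableSet (ellipsoid a) :=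
  measurableSet_le (by fun_prop) measurable_const

theorem volume_ellipsoid_ne_top {n : ℕ} {a : Fin n → ℝ} (ha : ∀ j, 0 < a j) :
    volume (ellipsoid a) ≠ ⊤ := by
  have hpi := Real.pi_gt_three
  have key : ∀ p ∈ ellipsoid a, ∀ j, (p.1 j) ^ 2 + (p.2 j) ^ 2 ≤ a j := by
    intro p hp j
    have h0 : ∀ i, 0 ≤ ((p.1 i) ^ 2 + (p.2 i) ^ 2) / a i := fun i => by
      have := ha i
      positivity
    have h1 := Finset.single_le_sum (fun i _ => h0 i) (Finset.mem_univ j)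
    have h2 : 2 * Real.pi * ∑ j, ((p.1 j) ^ 2 + (p.2 j) ^ 2) / a j ≤ 1 := hp
    have h3 := Finset.sum_nonneg fun i (_ : i ∈ Finset.univ) => h0 i
    have h4 : ((p.1 j) ^ 2 + (p.2 j) ^ 2) / a j ≤ 1 := by nlinarith
    exact (div_le_one (ha j)).1 h4
  -- The norm on the product is the maximum of the two Euclidean norms, so `x` and `ξ` are bounded
  -- separately.
  have hsub : ellipsoid a ⊆ Metric.closedBall 0 (Real.sqrt (∑ j, a j)) := by
    intro p hp
    rw [mem_closedBall_zero_iff, Prod.norm_def, max_le_iff, EuclideanSpace.norm_eq,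
      EuclideanSpace.norm_eq]
    constructor <;>
    · refine Real.sqrt_le_sqrt (Finset.sum_le_sum fun j _ => ?_)
      rw [Real.norm_eq_abs, sq_abs]
      have := key p hp j
      nlinarith [sq_nonneg (p.1 j), sq_nonneg (p.2 j)]
  exact ((measure_mono hsub).trans_lt measure_closedBall_lt_top).ne

/-! ### The tensor Hermite functions form a Hilbert basis -/

-- Injectivity of the Fourier transform on `L¹`: a test function is the Fourier transform of a
-- Schwartz function, and the transform can be moved onto `f` under the integral.
open scoped FourierTransform ContDiff in
theorem ae_eq_zero_of_fourier_eq_zero {V : Type*} [NormedAddCommGroup V] [InnerProductSpace ℝ V]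
    [FiniteDimensional ℝ V] [MeasurableSpace V] [BorelSpace V] {f : V → ℂ} (hf : Integrable f)
    (h : ∀ ξ, 𝓕 f ξ = 0) : ∀ᵐ x, f x = 0 := by
  refine ae_eq_zero_of_integral_contDiff_smul_eq_zero hf.locallyIntegrable fun g hg hgc => ?_
  have hg₁ : HasCompactSupport (Complex.ofRealCLM ∘ g) := hgc.comp_left rfl
  have hg₂ : ContDiff ℝ ∞ (Complex.ofRealCLM ∘ g) := by fun_prop
  let G : SchwartzMap V ℂ := hg₁.toSchwartzMap hg₂
  have h1 : ∫ ξ, 𝓕 (𝓕⁻ G : SchwartzMap V ℂ) ξ • f ξ = ∫ x, (𝓕⁻ G : SchwartzMap V ℂ) x • 𝓕 f x := by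
    have h2 := VectorFourier.integral_fourierIntegral_smul_eq_flip (L := innerₗ V)
      Real.continuous_fourierChar continuous_inner
      ((𝓕⁻ G : SchwartzMap V ℂ).integrable (μ := volume)) hf
    rw [flip_innerₗ] at h2
    exact h2
  rw [FourierTransform.fourier_fourierInv_eq] at h1
  simp only [h, smul_zero, integral_zero] at h1
  rw [← h1]
  rfl

theorem integral_euclidean_prod {n : ℕ} (f : Fin n → ℝ → ℂ) :
    ∫ x : EuclideanSpace ℝ (Fin n), ∏ j, f j (x j) = ∏ j, ∫ t : ℝ, f j t := by
  rw [← (PiLp.volume_preserving_toLp (Fin n)).integral_comp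
    (MeasurableEquiv.toLp 2 _).measurableEmbedding]
  exact integral_fintype_prod_volume_eq_prod f

theorem inner_hermiteL2 {n : ℕ} (α : Fin n → ℕ) (u : L2 n) :
    inner ℂ (hermiteL2 α) u = ∫ x, hermiteTensor α x * u x := by
  rw [L2.inner_def]
  refine integral_congr_ae ?_
  filter_upwards [(memLp_hermiteTensor α).coeFn_toLp] with x hx
  rw [hermiteL2, hx, RCLike.inner_apply, hermiteTensor, Complex.conj_ofReal, mul_comm]

theorem inner_hermiteL2_hermiteL2 {n : ℕ} (α β : Fin n → ℕ) :
    inner ℂ (hermiteL2 α) (hermiteL2 β) = if α = β then 1 else 0 := by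
  have h : inner ℂ (hermiteL2 α) (hermiteL2 β) = ∫ x : EuclideanSpace ℝ (Fin n),
      ∏ j, ((hermiteFun (α j) (x j) * hermiteFun (β j) (x j) : ℝ) : ℂ) := by
    rw [inner_hermiteL2]
    refine integral_congr_ae ?_
    filter_upwards [(memLp_hermiteTensor β).coeFn_toLp] with x hx
    rw [hermiteL2, hx, hermiteTensor, hermiteTensor, ← Complex.ofReal_mul,
      ← Finset.prod_mul_distrib, Complex.ofReal_prod]
  rw [h, integral_euclidean_prod
    (fun j t => ((hermiteFun (α j) t * hermiteFun (β j) t : ℝ) : ℂ))]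
  simp only [integral_hermiteFun_mul, funext_iff, Finset.prod_boole, Finset.mem_univ, true_imp_iff]

theorem orthonormal_hermiteL2 (n : ℕ) : Orthonormal ℂ (hermiteL2 : (Fin n → ℕ) → L2 n) :=
  orthonormal_iff_ite.2 inner_hermiteL2_hermiteL2

/-- The tensor product of Hermite polynomials. -/
def hermitePolyTensor {n : ℕ} (α : Fin n → ℕ) (x : EuclideanSpace ℝ (Fin n)) : ℂ :=
  ∏ j, (((hermitePoly (α j)).eval (x j) : ℝ) : ℂ)

/-- The space of polynomial functions spanned by the products of Hermite polynomials. -/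
def hermiteSpan (n : ℕ) : Submodule ℂ (EuclideanSpace ℝ (Fin n) → ℂ) :=
  Submodule.span ℂ (Set.range hermitePolyTensor)

theorem hermitePolyTensor_update {n : ℕ} (α : Fin n → ℕ) (j : Fin n) (m : ℕ)
    (x : EuclideanSpace ℝ (Fin n)) : hermitePolyTensor (Function.update α j m) x =
      (((hermitePoly m).eval (x j) : ℝ) : ℂ) *
        ∏ i ∈ Finset.univ.erase j, (((hermitePoly (α i)).eval (x i) : ℝ) : ℂ) := by
  rw [hermitePolyTensor, ← Finset.mul_prod_erase _ _ (Finset.mem_univ j), Function.update_self]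
  congr 1
  refine Finset.prod_congr rfl fun i hi => ?_
  rw [Function.update_of_ne (Finset.ne_of_mem_erase hi)]

theorem coord_mul_hermitePolyTensor {n : ℕ} (α : Fin n → ℕ) (j : Fin n) :
    (fun x : EuclideanSpace ℝ (Fin n) => ((x j : ℝ) : ℂ) * hermitePolyTensor α x) =
      (hermiteScale⁻¹ : ℂ) • (hermitePolyTensor (Function.update α j (α j + 1)) +
        (α j : ℂ) • hermitePolyTensor (Function.update α j (α j - 1))) := by
  funext x
  have h := hermitePolyTensor_update α j (α j) x
  rw [Function.update_eq_self] at h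
  simp only [Pi.smul_apply, Pi.add_apply, smul_eq_mul, hermitePolyTensor_update, h,
    hermitePoly_succ, Polynomial.eval_sub, Polynomial.eval_mul, Polynomial.eval_C,
    Polynomial.eval_X]
  have hc : (hermiteScale : ℂ) ≠ 0 := by exact_mod_cast hermiteScale_pos.ne'
  push_cast
  field_simp
  ring

theorem coord_mul_mem_hermiteSpan {n : ℕ} (j : Fin n) {q : EuclideanSpace ℝ (Fin n) → ℂ}
    (hq : q ∈ hermiteSpan n) :
    (fun x : EuclideanSpace ℝ (Fin n) => ((x j : ℝ) : ℂ) * q x) ∈ hermiteSpan n := by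
  induction hq using Submodule.span_induction with
  | mem q hq =>
    obtain ⟨α, rfl⟩ := hq
    rw [coord_mul_hermitePolyTensor]
    exact Submodule.smul_mem _ _ (Submodule.add_mem _ (Submodule.subset_span ⟨_, rfl⟩)
      (Submodule.smul_mem _ _ (Submodule.subset_span ⟨_, rfl⟩)))
  | zero =>
    convert Submodule.zero_mem (hermiteSpan n) using 1
    funext x
    simp
  | add p q _ _ hp hq =>
    convert Submodule.add_mem _ hp hq using 1
    funext x
    simp [mul_add]
  | smul a q _ hq =>
    convert Submodule.smul_mem _ a hq using 1
    funext x
    simp [mul_left_comm]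

/-- These are the Taylor terms of the Fourier character; the span contains them because it contains
`1` and is stable under multiplication by coordinates. -/
theorem inner_pow_mem_hermiteSpan {n : ℕ} (ξ : EuclideanSpace ℝ (Fin n)) (m : ℕ) :
    (fun x : EuclideanSpace ℝ (Fin n) => ((inner ℝ x ξ : ℝ) : ℂ) ^ m) ∈ hermiteSpan n := by
  induction m with
  | zero =>
    refine Submodule.subset_span ⟨0, ?_⟩
    funext x
    simp [hermitePolyTensor, hermitePoly]
  | succ m ih =>
    have h := Submodule.sum_mem (hermiteSpan n) (t := Finset.univ) fun j _ =>
      Submodule.smul_mem _ ((ξ j : ℝ) : ℂ) (coord_mul_mem_hermiteSpan j ih)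
    convert h using 1
    funext x
    simp only [Finset.sum_apply, Pi.smul_apply, smul_eq_mul, pow_succ', ← mul_assoc,
      ← Finset.sum_mul]
    rw [PiLp.inner_apply, Complex.ofReal_sum]
    congr 1
    refine Finset.sum_congr rfl fun j _ => ?_
    simp

theorem hermiteTensor_eq {n : ℕ} (α : Fin n → ℕ) : ∃ c : ℂ, c ≠ 0 ∧
    ∀ x, hermiteTensor α x = c * (hermitePolyTensor α x *
      (Real.exp (-(Real.pi * ‖x‖ ^ 2)) : ℝ)) := by
  refine ⟨((∏ j, (2 : ℝ) ^ (1 / 4 : ℝ) / Real.sqrt (α j).factorial : ℝ) : ℂ), ?_, fun x => ?_⟩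
  · rw [Complex.ofReal_ne_zero, Finset.prod_ne_zero_iff]
    intro j _
    positivity
  · rw [hermiteTensor, hermitePolyTensor, ← Complex.ofReal_prod, ← Complex.ofReal_mul,
      ← Complex.ofReal_mul, EuclideanSpace.norm_sq_eq, Finset.mul_sum, ← Finset.sum_neg_distrib,
      Real.exp_sum, ← Finset.prod_mul_distrib, ← Finset.prod_mul_distrib]
    congr 1
    refine Finset.prod_congr rfl fun j _ => ?_
    rw [hermiteFun_eq_hermitePoly, Real.norm_eq_abs, sq_abs]

theorem integral_hermiteSpan_eq_zero {n : ℕ} {u : L2 n}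
    (hu : ∀ α, inner ℂ (hermiteL2 α) u = 0) {q : EuclideanSpace ℝ (Fin n) → ℂ}
    (hq : q ∈ hermiteSpan n) :
    Integrable (fun x => q x * ((Real.exp (-(Real.pi * ‖x‖ ^ 2)) : ℝ) * u x)) ∧
      ∫ x, q x * ((Real.exp (-(Real.pi * ‖x‖ ^ 2)) : ℝ) * u x) = 0 := by
  induction hq using Submodule.span_induction with
  | mem q hq =>
    obtain ⟨α, rfl⟩ := hq
    obtain ⟨c, hc, h⟩ := hermiteTensor_eq α
    have e : (fun x => hermitePolyTensor α x * ((Real.exp (-(Real.pi * ‖x‖ ^ 2)) : ℝ) * u x)) =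
        fun x => c⁻¹ * (hermiteTensor α x * u x) := by
      funext x
      rw [h]
      field_simp
    rw [e]
    refine ⟨((memLp_hermiteTensor α).integrable_mul (Lp.memLp u)).const_mul _, ?_⟩
    rw [integral_const_mul, ← inner_hermiteL2, hu, mul_zero]
  | zero => simp
  | add p q _ _ hp hq =>
    simp only [Pi.add_apply, add_mul]
    exact ⟨hp.1.add hq.1, by rw [integral_add hp.1 hq.1, hp.2, hq.2, add_zero]⟩
  | smul a q _ hq =>
    simp only [Pi.smul_apply, smul_eq_mul, mul_assoc]
    exact ⟨hq.1.const_mul a, by rw [integral_const_mul, hq.2, mul_zero]⟩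

/-- Paired with `u ∈ L²`, this gives `e^{-π|x|²} u` exponential moments of every order, the
domination needed for completeness. -/
theorem memLp_gaussian_mul_exp_inner {n : ℕ} (ξ : EuclideanSpace ℝ (Fin n)) :
    MemLp (fun x : EuclideanSpace ℝ (Fin n) =>
      Real.exp (-(Real.pi * ‖x‖ ^ 2)) * Real.exp (inner ℝ ξ x)) 2 := by
  have hc : Continuous fun x : EuclideanSpace ℝ (Fin n) =>
      Real.exp (-(Real.pi * ‖x‖ ^ 2)) * Real.exp (inner ℝ ξ x) := by fun_prop
  rw [memLp_two_iff_integrable_sq hc.aestronglyMeasurable]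
  have h := (GaussianFourier.integrable_cexp_neg_mul_sq_norm_add (b := 2 * Real.pi)
    (by have := Real.pi_pos; simpa using this) 2 ξ).norm
  refine h.congr (Filter.Eventually.of_forall fun x => ?_)
  have e : (-(2 * Real.pi) * ‖x‖ ^ 2 + 2 * (inner ℝ ξ x : ℝ) : ℂ) =
      ((2 * (-(Real.pi * ‖x‖ ^ 2) + inner ℝ ξ x) : ℝ) : ℂ) := by
    push_cast
    ring
  simp only
  rw [e, Complex.norm_exp_ofReal, ← Real.exp_add, ← Real.exp_nat_mul]
  norm_num

-- Completeness of the Hermite functions. If `u` is orthogonal to all of them, then `g = e^{-π|x|²}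
-- u` integrates to zero against every element of `hermiteSpan`. Expanding the character in a power
-- series and integrating term by term gives `𝓕 g = 0`, so `g`, and with it `u`, vanishes.
open scoped FourierTransform in
theorem eq_zero_of_inner_hermiteL2 {n : ℕ} {u : L2 n}
    (hu : ∀ α, inner ℂ (hermiteL2 α) u = 0) : u = 0 := by
  set g : EuclideanSpace ℝ (Fin n) → ℂ := fun x =>
    (Real.exp (-(Real.pi * ‖x‖ ^ 2)) : ℝ) * u x with hg
  have hexp : ∀ ξ : EuclideanSpace ℝ (Fin n),
      Integrable fun x => ‖g x‖ * Real.exp (inner ℝ ξ x) := by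
    intro ξ
    refine ((memLp_gaussian_mul_exp_inner ξ).integrable_mul (Lp.memLp u).norm).congr
      (Filter.Eventually.of_forall fun x => ?_)
    simp only [hg, Pi.mul_apply, norm_mul, Complex.norm_real, Real.norm_eq_abs, Real.abs_exp]
    ring
  have hgm : AEStronglyMeasurable g volume :=
    AEStronglyMeasurable.mul (Continuous.aestronglyMeasurable (by fun_prop))
      (Lp.aestronglyMeasurable u)
  have hgi : Integrable g := by
    have := hexp 0
    simp only [inner_zero_left, Real.exp_zero, mul_one] at this
    exact (integrable_norm_iff hgm).1 this
  have hF : ∀ ξ, 𝓕 g ξ = 0 := by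
    intro ξ
    rw [Real.fourier_eq']
    set c : ℂ := ((-2 * Real.pi : ℝ) : ℂ) * Complex.I with hc
    have hcn : ‖c‖ = 2 * Real.pi := by
      rw [hc, norm_mul, Complex.norm_I, mul_one, Complex.norm_real, Real.norm_eq_abs, abs_mul,
        abs_of_pos Real.pi_pos]
      norm_num
    have hterm : ∀ m : ℕ, ∫ x, (c * (inner ℝ x ξ : ℝ)) ^ m / (m.factorial : ℂ) * g x = 0 := by
      intro m
      have h := (integral_hermiteSpan_eq_zero hu (inner_pow_mem_hermiteSpan ξ m)).2
      have e : (fun x => (c * (inner ℝ x ξ : ℝ)) ^ m / (m.factorial : ℂ) * g x) =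
          fun x => c ^ m / (m.factorial : ℂ) * (((inner ℝ x ξ : ℝ) : ℂ) ^ m * g x) := by
        funext x
        rw [mul_pow]
        ring
      rw [e, integral_const_mul, h, mul_zero]
    have hsum : ∀ x, HasSum (fun m : ℕ => (c * (inner ℝ x ξ : ℝ)) ^ m / (m.factorial : ℂ) * g x)
        (Complex.exp (c * (inner ℝ x ξ : ℝ)) * g x) := by
      intro x
      rw [Complex.exp_eq_exp_ℂ]
      exact (NormedSpace.expSeries_div_hasSum_exp (c * (inner ℝ x ξ : ℝ))).mul_right _
    have hnsum : ∀ x, HasSum (fun m : ℕ => |2 * Real.pi * inner ℝ x ξ| ^ m / (m.factorial : ℝ) *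
        ‖g x‖) (Real.exp |2 * Real.pi * inner ℝ x ξ| * ‖g x‖) := by
      intro x
      rw [Real.exp_eq_exp_ℝ]
      exact (NormedSpace.expSeries_div_hasSum_exp |2 * Real.pi * inner ℝ x ξ|).mul_right _
    have h := hasSum_integral_of_dominated_convergence (μ := volume)
      (F := fun (m : ℕ) x => (c * (inner ℝ x ξ : ℝ)) ^ m / (m.factorial : ℂ) * g x)
      (f := fun x => Complex.exp (c * (inner ℝ x ξ : ℝ)) * g x)
      (fun (m : ℕ) x => |2 * Real.pi * inner ℝ x ξ| ^ m / (m.factorial : ℝ) * ‖g x‖)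
      (fun m => AEStronglyMeasurable.mul (Continuous.aestronglyMeasurable (by fun_prop)) hgm)
      (fun m => Filter.Eventually.of_forall fun x => by
        rw [norm_mul, norm_div, norm_pow, norm_mul, hcn, Complex.norm_real, Complex.norm_natCast,
          abs_mul, abs_of_pos (by have := Real.pi_pos; positivity : 0 < 2 * Real.pi),
          Real.norm_eq_abs])
      (Filter.Eventually.of_forall fun x => (hnsum x).summable) ?_
      (Filter.Eventually.of_forall hsum)
    · simp only [hterm] at h
      have h0 := h.unique hasSum_zero
      rw [← h0]
      refine integral_congr_ae (Filter.Eventually.of_forall fun x => ?_)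
      simp only [smul_eq_mul, hc]
      push_cast
      congr 2
      ring
    · simp only [(hnsum _).tsum_eq]
      -- Domination by `e^{|s|} ≤ e^s + e^{-s}` with `s = 2π⟨x, ξ⟩`.
      refine ((hexp ((2 * Real.pi) • ξ)).add (hexp (-((2 * Real.pi) • ξ)))).mono'
        (AEStronglyMeasurable.mul (Continuous.aestronglyMeasurable (by fun_prop)) hgm.norm)
        (Filter.Eventually.of_forall fun x => ?_)
      rw [Real.norm_of_nonneg (by positivity), Pi.add_apply, ← mul_add, mul_comm, inner_neg_left,
        real_inner_smul_left, real_inner_comm x ξ]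
      refine mul_le_mul_of_nonneg_left ?_ (norm_nonneg _)
      rcases abs_cases (2 * Real.pi * inner ℝ x ξ) with ⟨h, -⟩ | ⟨h, -⟩ <;> rw [h]
      · exact le_add_of_nonneg_right (Real.exp_pos _).le
      · exact le_add_of_nonneg_left (Real.exp_pos _).le
  rw [Lp.eq_zero_iff_ae_eq_zero]
  filter_upwards [ae_eq_zero_of_fourier_eq_zero hgi hF] with x hx
  simpa [hg] using hx

/-- The Hilbert basis of tensor Hermite functions. -/
def hermiteBasis (n : ℕ) : HilbertBasis (Fin n → ℕ) ℂ (L2 n) :=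
  HilbertBasis.mkOfOrthogonalEqBot (orthonormal_hermiteL2 n) (by
    rw [Submodule.eq_bot_iff]
    intro u hu
    refine eq_zero_of_inner_hermiteL2 fun α => ?_
    exact (Submodule.mem_orthogonal _ u).1 hu _ (Submodule.subset_span ⟨α, rfl⟩))

theorem hermiteBasis_apply {n : ℕ} (α : Fin n → ℕ) : hermiteBasis n α = hermiteL2 α := by
  rw [hermiteBasis, HilbertBasis.coe_mkOfOrthogonalEqBot]

theorem hermiteProj_apply {n : ℕ} (α : Fin n → ℕ) (u : L2 n) :
    hermiteProj α u = (inner ℂ (hermiteL2 α) u : ℂ) • hermiteL2 α :=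
  Submodule.starProjection_unit_singleton ℂ ((orthonormal_hermiteL2 n).1 α) u

/-- By completeness, a diagonal matrix forces each basis vector to be an eigenvector; applying the
continuous `A` to the basis expansion of `u` gives the sum. -/
theorem hasSum_of_apply_hermiteL2 {n : ℕ} {A : L2 n →L[ℂ] L2 n} {F : (Fin n → ℕ) → ℂ}
    (h : ∀ α β, inner ℂ (hermiteL2 β) (A (hermiteL2 α)) = if α = β then F α else 0) (u : L2 n) :
    HasSum (fun α => F α • hermiteProj α u) (A u) := by
  have hA : ∀ α, A (hermiteL2 α) = F α • hermiteL2 α := by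
    intro α
    rw [← sub_eq_zero]
    refine eq_zero_of_inner_hermiteL2 fun β => ?_
    rw [inner_sub_right, h, inner_smul_right, inner_hermiteL2_hermiteL2]
    by_cases hαβ : α = β
    · simp [hαβ]
    · simp [hαβ, Ne.symm hαβ]
  have h1 := A.hasSum ((hermiteBasis n).hasSum_repr u)
  convert h1 using 1
  funext α
  rw [hermiteProj_apply, map_smul, hermiteBasis_apply, hA, HilbertBasis.repr_apply_apply,
    hermiteBasis_apply, smul_comm]

/-! ### The Wigner functions of tensor Hermite functions -/

theorem wigner_hermiteTensor {n : ℕ} (α β : Fin n → ℕ) (p : Phase n) :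
    wigner (hermiteTensor α) (hermiteTensor β) p =
      ∏ j, hermiteWigner (α j) (β j) ⟨p.1 j, p.2 j⟩ := by
  simp only [← integral_wigner_hermiteFun]
  rw [← integral_euclidean_prod, wigner]
  refine integral_congr_ae (Filter.Eventually.of_forall fun z => ?_)
  simp only [Finset.prod_mul_distrib, ← Complex.exp_sum, hermiteTensor, Complex.conj_ofReal,
    ← Complex.ofReal_prod]
  congr 2
  rw [PiLp.inner_apply, ← Finset.sum_mul, Finset.mul_sum, Complex.ofReal_sum,
    Finset.sum_neg_distrib]
  congr 2
  refine Finset.sum_congr rfl fun j _ => ?_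
  simp [mul_comm]

/-- Phase space as `ℂⁿ`, through `ζ = x + i ξ`. -/
def phaseEquiv (n : ℕ) : (Fin n → ℂ) ≃ᵐ Phase n :=
  ((MeasurableEquiv.piCongrRight fun _ => Complex.measurableEquivRealProd).trans
    (MeasurableEquiv.arrowProdEquivProdArrow ℝ ℝ (Fin n))).trans
    ((MeasurableEquiv.toLp 2 (Fin n → ℝ)).prodCongr (MeasurableEquiv.toLp 2 (Fin n → ℝ)))

theorem measurePreserving_phaseEquiv (n : ℕ) : MeasurePreserving (phaseEquiv n) :=
  ((PiLp.volume_preserving_toLp (Fin n)).prod (PiLp.volume_preserving_toLp (Fin n))).comp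
    ((volume_measurePreserving_arrowProdEquivProdArrow ℝ ℝ (Fin n)).comp
      (volume_preserving_pi fun _ => Complex.volume_preserving_equiv_real_prod))

theorem phaseEquiv_fst {n : ℕ} (ζ : Fin n → ℂ) (j : Fin n) :
    (phaseEquiv n ζ).1 j = (ζ j).re := rfl

theorem phaseEquiv_snd {n : ℕ} (ζ : Fin n → ℂ) (j : Fin n) :
    (phaseEquiv n ζ).2 j = (ζ j).im := rfl

/-- The ellipsoid in complex coordinates. -/
def complexEllipsoid {n : ℕ} (a : Fin n → ℝ) : Set (Fin n → ℂ) :=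
  {ζ | ∑ j, (2 * (Real.pi * ‖ζ j‖ ^ 2)) / a j ≤ 1}

theorem setIntegral_ellipsoid_wigner {n : ℕ} (a : Fin n → ℝ) (α β : Fin n → ℕ) :
    ∫ p in ellipsoid a, wigner (hermiteTensor α) (hermiteTensor β) p =
      ∫ ζ : Fin n → ℂ, (complexEllipsoid a).indicator
        (fun ζ => ∏ j, hermiteWigner (α j) (β j) (ζ j)) ζ := by
  rw [← integral_indicator (measurableSet_ellipsoid a),
    ← (measurePreserving_phaseEquiv n).integral_comp']
  refine integral_congr_ae (Filter.Eventually.of_forall fun ζ => ?_)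
  have h : phaseEquiv n ζ ∈ ellipsoid a ↔ ζ ∈ complexEllipsoid a := by
    simp only [ellipsoid, complexEllipsoid, Set.mem_ofPred_eq, phaseEquiv_fst, phaseEquiv_snd,
      Finset.mul_sum]
    refine iff_of_eq (congrArg (· ≤ (1 : ℝ)) (Finset.sum_congr rfl fun j _ => ?_))
    rw [← Complex.normSq_eq_norm_sq, Complex.normSq_apply]
    ring
  simp only
  by_cases hζ : ζ ∈ complexEllipsoid a
  · rw [Set.indicator_of_mem hζ, Set.indicator_of_mem (h.2 hζ), wigner_hermiteTensor]
    rfl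
  · rw [Set.indicator_of_notMem hζ, Set.indicator_of_notMem (mt h.1 hζ)]

/-! ### Off-diagonal terms -/

/-- The angle `π / (l - k)`, with the difference taken in `ℝ`, makes `c^(l-k) = e^{iπ} = -1`. -/
theorem exists_circle_hermiteWigner_neg {k l : ℕ} (h : k ≠ l) :
    ∃ c : Circle, ∀ ζ : ℂ, hermiteWigner k l (c * ζ) = -hermiteWigner k l ζ := by
  have hkl : (l : ℂ) - k ≠ 0 := by
    rw [sub_ne_zero]
    exact_mod_cast h.symm
  refine ⟨Circle.exp (Real.pi / (l - k)), fun ζ => ?_⟩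
  set c := Circle.exp (Real.pi / (l - k)) with hc
  have hcl : (c : ℂ) ^ l = -(c : ℂ) ^ k := by
    rw [hc, Circle.coe_exp, ← Complex.exp_nat_mul, ← Complex.exp_nat_mul]
    push_cast
    have e : (l : ℂ) * (Real.pi / (l - k) * Complex.I) =
        k * (Real.pi / (l - k) * Complex.I) + Real.pi * Complex.I := by
      field_simp
      ring
    rw [e, Complex.exp_add, Complex.exp_pi_mul_I]
    ring
  have h1 := hermiteWigner_mul_circle k l c ζ
  rw [hcl] at h1
  have h2 : (c : ℂ) ^ k ≠ 0 := pow_ne_zero _ (Circle.coe_ne_zero c)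
  exact mul_right_cancel₀ h2 (by rw [h1]; ring)

/-- Rotate only a coordinate `j` where `α j ≠ β j`: measure and ellipsoid are preserved while the
integrand changes sign, so the integral equals its own negative. -/
theorem setIntegral_ellipsoid_wigner_of_ne {n : ℕ} (a : Fin n → ℝ) {α β : Fin n → ℕ}
    (h : α ≠ β) : ∫ p in ellipsoid a, wigner (hermiteTensor α) (hermiteTensor β) p = 0 := by
  obtain ⟨j, hj⟩ := Function.ne_iff.1 h
  obtain ⟨c, hc⟩ := exists_circle_hermiteWigner_neg hj
  rw [setIntegral_ellipsoid_wigner]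
  set f := (complexEllipsoid a).indicator (fun ζ => ∏ j, hermiteWigner (α j) (β j) (ζ j)) with hf
  let d : Fin n → Circle := Function.update 1 j c
  have hdj : d j = c := by simp [d]
  have hdi : ∀ i, i ≠ j → d i = 1 := fun i hi => by simp [d, hi]
  let T : (Fin n → ℂ) ≃ᵐ (Fin n → ℂ) :=
    MeasurableEquiv.piCongrRight fun i => (rotation (d i)).toHomeomorph.toMeasurableEquiv
  have hT : MeasurePreserving T :=
    volume_preserving_pi fun i => (rotation (d i)).measurePreserving
  have hTa : ∀ ζ i, T ζ i = (d i : ℂ) * ζ i := fun ζ i => rfl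
  have hfT : ∀ ζ, f (T ζ) = -f ζ := by
    intro ζ
    have hmem : T ζ ∈ complexEllipsoid a ↔ ζ ∈ complexEllipsoid a := by
      simp only [complexEllipsoid, Set.mem_ofPred_eq, hTa, norm_mul, Circle.norm_coe, one_mul]
    have hprod : ∏ i, hermiteWigner (α i) (β i) (T ζ i) =
        -∏ i, hermiteWigner (α i) (β i) (ζ i) := by
      rw [← Finset.mul_prod_erase _ _ (Finset.mem_univ j),
        ← Finset.mul_prod_erase Finset.univ (fun i => hermiteWigner (α i) (β i) (ζ i))
          (Finset.mem_univ j), hTa, hdj, hc, neg_mul]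
      congr 2
      refine Finset.prod_congr rfl fun i hi => ?_
      rw [hTa, hdi i (Finset.ne_of_mem_erase hi), Circle.coe_one, one_mul]
    by_cases hζ : ζ ∈ complexEllipsoid a
    · rw [hf, Set.indicator_of_mem hζ, Set.indicator_of_mem (hmem.2 hζ), hprod]
    · rw [hf, Set.indicator_of_notMem hζ, Set.indicator_of_notMem (mt hmem.1 hζ), neg_zero]
  have h1 := hT.integral_comp' f
  simp only [hfT, integral_neg] at h1
  exact self_eq_neg.1 h1.symm

/-! ### Diagonal terms -/

theorem volume_pi_mul_norm_sq_le (b : ℝ) :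
    volume {ζ : ℂ | Real.pi * ‖ζ‖ ^ 2 ≤ b} = ENNReal.ofReal b := by
  have hpi := Real.pi_pos
  rcases lt_or_ge b 0 with hb | hb
  · have : {ζ : ℂ | Real.pi * ‖ζ‖ ^ 2 ≤ b} = ∅ := by
      ext ζ
      have : 0 ≤ Real.pi * ‖ζ‖ ^ 2 := by positivity
      simp only [Set.mem_ofPred_eq, Set.mem_empty_iff_false, iff_false]
      linarith
    rw [this, measure_empty, ENNReal.ofReal_of_nonpos hb.le]
  · have : {ζ : ℂ | Real.pi * ‖ζ‖ ^ 2 ≤ b} = Metric.closedBall 0 (Real.sqrt (b / Real.pi)) := by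
      ext ζ
      rw [mem_closedBall_zero_iff, Real.le_sqrt (norm_nonneg _) (by positivity),
        le_div_iff₀ hpi, mul_comm]
      rfl
    have h2 : (NNReal.pi : ENNReal) = ENNReal.ofReal Real.pi := by
      rw [← NNReal.coe_real_pi, ENNReal.ofReal_coe_nnreal]
    rw [this, Complex.volume_closedBall, ← ENNReal.ofReal_pow (Real.sqrt_nonneg _),
      Real.sq_sqrt (by positivity), h2, ← ENNReal.ofReal_mul (by positivity),
      div_mul_cancel₀ _ hpi.ne']

/-- Polar coordinates in disguise: the disc `π|ζ|² ≤ b` has area `b`, so the two measures agree on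
every interval `(a, b]`. -/
theorem measurePreserving_pi_mul_norm_sq :
    MeasurePreserving (fun ζ : ℂ => Real.pi * ‖ζ‖ ^ 2) volume
      (volume.restrict (Set.Ici (0 : ℝ))) := by
  have hm : Measurable fun ζ : ℂ => Real.pi * ‖ζ‖ ^ 2 := by fun_prop
  refine ⟨hm, (Measure.ext_of_Ioc _ _ fun a b hab => ?_).symm⟩
  have e : (fun ζ : ℂ => Real.pi * ‖ζ‖ ^ 2) ⁻¹' Set.Ioc a b =
      {ζ : ℂ | Real.pi * ‖ζ‖ ^ 2 ≤ b} \ {ζ : ℂ | Real.pi * ‖ζ‖ ^ 2 ≤ a} := by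
    ext ζ
    simp [and_comm]
  have hsub : {ζ : ℂ | Real.pi * ‖ζ‖ ^ 2 ≤ a} ⊆ {ζ : ℂ | Real.pi * ‖ζ‖ ^ 2 ≤ b} :=
    fun ζ (hζ : Real.pi * ‖ζ‖ ^ 2 ≤ a) => hζ.trans hab.le
  rw [Measure.restrict_apply measurableSet_Ioc, Measure.map_apply hm measurableSet_Ioc, e,
    measure_sdiff hsub
      (measurableSet_le hm measurable_const).nullMeasurableSet
      (by rw [volume_pi_mul_norm_sq_le]; exact ENNReal.ofReal_ne_top),
    volume_pi_mul_norm_sq_le, volume_pi_mul_norm_sq_le]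
  rcases lt_or_ge a 0 with ha | ha
  · have : Set.Ioc a b ∩ Set.Ici 0 = Set.Icc 0 b := by
      ext x
      simp only [Set.mem_inter_iff, Set.mem_Ioc, Set.mem_Ici, Set.mem_Icc]
      exact ⟨fun h => ⟨h.2, h.1.2⟩, fun h => ⟨⟨ha.trans_le h.1, h.2⟩, h.1⟩⟩
    rw [this, Real.volume_Icc, ENNReal.ofReal_of_nonpos ha.le, sub_zero, tsub_zero]
  · rw [Set.inter_eq_left.2 fun x hx => Set.mem_Ici.2 (ha.trans hx.1.le), Real.volume_Ioc,
      ENNReal.ofReal_sub _ ha]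

/-! ### Laguerre integrals over the orthant -/

/-- The closed positive orthant. -/
def orthant (n : ℕ) : Set (Fin n → ℝ) := Set.univ.pi fun _ => Set.Ici 0

theorem mem_orthant {n : ℕ} {t : Fin n → ℝ} : t ∈ orthant n ↔ ∀ j, 0 ≤ t j := by
  simp only [orthant, Set.mem_univ_pi, Set.mem_Ici]

theorem measurableSet_orthant (n : ℕ) : MeasurableSet (orthant n) :=
  MeasurableSet.univ_pi fun _ => measurableSet_Ici

theorem measurePreserving_pi_mul_norm_sq_pi (n : ℕ) :
    MeasurePreserving (fun (ζ : Fin n → ℂ) j => Real.pi * ‖ζ j‖ ^ 2) volume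
      (volume.restrict (orthant n)) := by
  have h := measurePreserving_pi (fun _ : Fin n => (volume : Measure ℂ))
    (fun _ : Fin n => (volume : Measure ℝ).restrict (Set.Ici 0))
    (fun _ => measurePreserving_pi_mul_norm_sq)
  rw [← Measure.restrict_pi_pi] at h
  exact h

/-- The one-dimensional factor of `coeffIntegrand`. -/
def coeffFactor (k : ℕ) (t : ℝ) : ℝ := Real.exp (-t) * ((-1) ^ k * laguerre k (2 * t))

theorem coeffIntegrand_eq_prod {n : ℕ} (α : Fin n → ℕ) (t : Fin n → ℝ) :
    coeffIntegrand α t = ∏ j, coeffFactor (α j) (t j) := by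
  rw [coeffIntegrand, ← Finset.sum_neg_distrib, Real.exp_sum, ← Finset.prod_mul_distrib]
  rfl

theorem hasIntegral_exp_neg_mul_pow (l : ℕ) :
    IntegrableOn (fun t : ℝ => Real.exp (-t) * t ^ l) (Set.Ioi 0) ∧
      ∫ t in Set.Ioi (0 : ℝ), Real.exp (-t) * t ^ l = l.factorial := by
  have hl : (0 : ℝ) < l + 1 := by positivity
  have h1 := Real.GammaIntegral_convergent hl
  have h2 := Real.Gamma_eq_integral hl
  simp only [add_sub_cancel_right, Real.rpow_natCast, Real.Gamma_nat_eq_factorial] at h1 h2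
  exact ⟨h1, h2.symm⟩

theorem coeffFactor_eq_sum (k : ℕ) (t : ℝ) : coeffFactor k t = ∑ l ∈ Finset.range (k + 1),
    ((-1) ^ k * ((-1) ^ l / (l.factorial : ℝ) * (k.choose l : ℝ) * 2 ^ l)) *
      (Real.exp (-t) * t ^ l) := by
  rw [coeffFactor, laguerre, Finset.mul_sum, Finset.mul_sum]
  refine Finset.sum_congr rfl fun l _ => ?_
  ring

theorem integrableOn_coeffFactor (k : ℕ) : IntegrableOn (coeffFactor k) (Set.Ici 0) := by
  rw [integrableOn_Ici_iff_integrableOn_Ioi, funext (coeffFactor_eq_sum k)]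
  exact integrable_finsetSum _ fun l _ => (hasIntegral_exp_neg_mul_pow l).1.const_mul _

/-- Since `∫ e^{-t} tˡ = l!`, the factorials cancel and the binomial theorem leaves `(-1)ᵏ (1 - 2)ᵏ
= 1`. This normalisation is where the `1` in `1 - K_α` comes from. -/
theorem setIntegral_coeffFactor (k : ℕ) : ∫ t in Set.Ici (0 : ℝ), coeffFactor k t = 1 := by
  rw [integral_Ici_eq_integral_Ioi, funext (coeffFactor_eq_sum k),
    integral_finsetSum _ fun l _ => (hasIntegral_exp_neg_mul_pow l).1.const_mul _]
  simp only [integral_const_mul, (hasIntegral_exp_neg_mul_pow _).2]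
  have h : ∑ l ∈ Finset.range (k + 1),
      ((-1 : ℝ) ^ k * ((-1) ^ l / (l.factorial : ℝ) * (k.choose l : ℝ) * 2 ^ l)) * l.factorial =
      (-1) ^ k * (-2 + 1) ^ k := by
    rw [add_pow, Finset.mul_sum]
    refine Finset.sum_congr rfl fun l _ => ?_
    have : (l.factorial : ℝ) ≠ 0 := by positivity
    rw [one_pow, neg_pow (2 : ℝ)]
    field_simp
  rw [h, ← mul_pow]
  norm_num

theorem integrableOn_coeffIntegrand_orthant {n : ℕ} (α : Fin n → ℕ) :
    IntegrableOn (coeffIntegrand α) (orthant n) := by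
  rw [IntegrableOn, orthant, volume_pi, Measure.restrict_pi_pi, funext (coeffIntegrand_eq_prod α)]
  exact Integrable.fintype_prod fun j => integrableOn_coeffFactor (α j)

theorem setIntegral_coeffIntegrand_orthant {n : ℕ} (α : Fin n → ℕ) :
    ∫ t in orthant n, coeffIntegrand α t = 1 := by
  rw [orthant, volume_pi, Measure.restrict_pi_pi, funext (coeffIntegrand_eq_prod α),
    integral_fintype_prod_eq_prod]
  simp only [setIntegral_coeffFactor, Finset.prod_const_one]

theorem integrableOn_coeffIntegrand {n : ℕ} (α : Fin n → ℕ) (a : Fin n → ℝ) :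
    IntegrableOn (coeffIntegrand α) (coeffDomain a) :=
  (integrableOn_coeffIntegrand_orthant α).mono_set fun _ ht j _ => ht.2 j

/-- An affine subspace missing the origin is proper, hence null. -/
theorem volume_sum_div_eq_one {n : ℕ} (a : Fin n → ℝ) :
    volume {t : Fin n → ℝ | ∑ j, t j / a j = 1} = 0 := by
  let s : AffineSubspace ℝ (Fin n → ℝ) :=
    { carrier := {t | ∑ j, t j / a j = 1}
      smul_vsub_vadd_mem' := fun c p q r hp hq hr => by
        simp only [Set.mem_ofPred_eq] at hp hq hr ⊢
        simp only [vsub_eq_sub, vadd_eq_add, Pi.add_apply, Pi.smul_apply, Pi.sub_apply,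
          smul_eq_mul, add_div, mul_div_assoc, sub_div, Finset.sum_add_distrib,
          Finset.sum_sub_distrib, ← Finset.mul_sum, hp, hq, hr]
        ring }
  refine Measure.addHaar_affineSubspace volume s fun hs => ?_
  have h0 : (0 : Fin n → ℝ) ∈ s := by rw [hs]; trivial
  have h1 : ∑ j, (0 : Fin n → ℝ) j / a j = 1 := h0
  simp at h1

/-- The integral over the orthant is `1`, so `1 - K_α` integrates over the complement of
`coeffDomain a`; this differs from the closed region only in a null hyperplane. -/
theorem coeffF_eq_setIntegral {n : ℕ} (α : Fin n → ℕ) (a : Fin n → ℝ) :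
    coeffF α a = ∫ t in orthant n ∩ {t | ∑ j, t j / a j ≤ 1}, coeffIntegrand α t := by
  have hm : Measurable fun t : Fin n → ℝ => ∑ j, t j / a j := by fun_prop
  have hd : MeasurableSet (coeffDomain a) := by
    have : coeffDomain a = {t | 1 ≤ ∑ j, t j / a j} ∩ orthant n := by
      ext t
      simp only [coeffDomain, Set.mem_inter_iff, mem_orthant, Set.mem_ofPred_eq]
    rw [this]
    exact (measurableSet_le measurable_const hm).inter (measurableSet_orthant n)
  have hsub : coeffDomain a ⊆ orthant n := fun _ ht j _ => ht.2 j
  have h1 : coeffF α a = (∫ t in orthant n, coeffIntegrand α t) - coeffK α a := by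
    rw [coeffF, setIntegral_coeffIntegrand_orthant]
  rw [h1, coeffK, ← setIntegral_sdiff hd (integrableOn_coeffIntegrand_orthant α) hsub]
  refine setIntegral_congr_set ?_
  have hne : ∀ᵐ t : Fin n → ℝ, ∑ j, t j / a j ≠ 1 := by
    rw [ae_iff]
    simpa using volume_sum_div_eq_one a
  filter_upwards [hne] with t ht
  refine propext ?_
  change t ∈ orthant n \ coeffDomain a ↔ t ∈ orthant n ∩ {t | ∑ j, t j / a j ≤ 1}
  simp only [Set.mem_sdiff, Set.mem_inter_iff, Set.mem_ofPred_eq, coeffDomain, not_and]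
  refine and_congr_right fun ho => ⟨fun h => ?_, fun h h1 => absurd (le_antisymm h h1) ht⟩
  by_contra hlt
  exact h (not_le.1 hlt).le fun j => ho j trivial

/-- Change of variables `tⱼ = 2π|ζⱼ|²` in two stages: `sⱼ = π|ζⱼ|²` preserves measure onto the
orthant, and `t = 2s` has a Jacobian cancelling the `2ⁿ` supplied by `hermiteWigner_self`. -/
theorem setIntegral_ellipsoid_wigner_self {n : ℕ} (a : Fin n → ℝ) (α : Fin n → ℕ) :
    ∫ p in ellipsoid a, wigner (hermiteTensor α) (hermiteTensor α) p = (coeffF α a : ℂ) := by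
  set S : Set (Fin n → ℝ) := {t | ∑ j, t j / a j ≤ 1} with hS
  have hSm : MeasurableSet S := measurableSet_le (by fun_prop) measurable_const
  have hcm : Measurable (coeffIntegrand α) := by
    unfold coeffIntegrand laguerre
    fun_prop
  let g : (Fin n → ℝ) → ℝ := S.indicator (coeffIntegrand α)
  have hg : Measurable g := hcm.indicator hSm
  have h1 : ∀ ζ : Fin n → ℂ, (complexEllipsoid a).indicator
      (fun ζ => ∏ j, hermiteWigner (α j) (α j) (ζ j)) ζ =
      ((2 ^ n * g ((2 : ℝ) • fun j => Real.pi * ‖ζ j‖ ^ 2) : ℝ) : ℂ) := by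
    intro ζ
    have hmem : ((2 : ℝ) • fun j => Real.pi * ‖ζ j‖ ^ 2) ∈ S ↔ ζ ∈ complexEllipsoid a := by
      simp [hS, complexEllipsoid]
    have hprod : ∏ j, hermiteWigner (α j) (α j) (ζ j) =
        ((2 ^ n * coeffIntegrand α ((2 : ℝ) • fun j => Real.pi * ‖ζ j‖ ^ 2) : ℝ) : ℂ) := by
      simp only [hermiteWigner_self]
      rw [← Complex.ofReal_prod, Finset.prod_mul_distrib, Finset.prod_const, Finset.card_univ,
        Fintype.card_fin, coeffIntegrand_eq_prod]
      rfl
    by_cases hζ : ζ ∈ complexEllipsoid a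
    · simp only [g]
      rw [Set.indicator_of_mem hζ, Set.indicator_of_mem (hmem.2 hζ), hprod]
    · simp only [g]
      rw [Set.indicator_of_notMem hζ, Set.indicator_of_notMem (mt hmem.1 hζ), mul_zero,
        Complex.ofReal_zero]
  rw [setIntegral_ellipsoid_wigner]
  simp only [h1]
  rw [integral_complex_ofReal, integral_const_mul, coeffF_eq_setIntegral]
  congr 1
  have hmp := measurePreserving_pi_mul_norm_sq_pi n
  have h2 : ∫ ζ : Fin n → ℂ, g ((2 : ℝ) • fun j => Real.pi * ‖ζ j‖ ^ 2) =
      ∫ s in orthant n, g ((2 : ℝ) • s) := by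
    have hg2 : Measurable fun s : Fin n → ℝ => g ((2 : ℝ) • s) := hg.comp (by fun_prop)
    rw [← hmp.map_eq, integral_map hmp.measurable.aemeasurable hg2.aestronglyMeasurable]
  have h3 : ∀ s : Fin n → ℝ, (orthant n).indicator (fun s => g ((2 : ℝ) • s)) s =
      (orthant n).indicator g ((2 : ℝ) • s) := by
    intro s
    have : (2 : ℝ) • s ∈ orthant n ↔ s ∈ orthant n := by simp [mem_orthant]
    by_cases hs : s ∈ orthant n
    · rw [Set.indicator_of_mem hs, Set.indicator_of_mem (this.2 hs)]
    · rw [Set.indicator_of_notMem hs, Set.indicator_of_notMem (mt this.1 hs)]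
  rw [h2, ← integral_indicator (measurableSet_orthant n)]
  simp only [h3]
  rw [Measure.integral_comp_smul, Module.finrank_fin_fun, abs_of_pos (by positivity), smul_eq_mul,
    mul_inv_cancel_left₀ (by positivity), integral_indicator (measurableSet_orthant n),
    setIntegral_indicator hSm]

end WeylEllipsoid

end

theorem mainTheorem6 (n : ℕ) (a : Fin n → ℝ) (ha : ∀ j, 0 < a j) :
    (∀ α : Fin n → ℕ, MeasureTheory.IntegrableOn (WeylEllipsoid.coeffIntegrand α)
      (WeylEllipsoid.coeffDomain a)) ∧
    (∃ A : WeylEllipsoid.L2 n →L[ℂ] WeylEllipsoid.L2 n,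
      WeylEllipsoid.IsWeylQuantization
        ((WeylEllipsoid.ellipsoid a).indicator (fun _ => (1 : ℂ))) A) ∧
    (∀ A : WeylEllipsoid.L2 n →L[ℂ] WeylEllipsoid.L2 n,
      WeylEllipsoid.IsWeylQuantization
        ((WeylEllipsoid.ellipsoid a).indicator (fun _ => (1 : ℂ))) A →
      ∀ u : WeylEllipsoid.L2 n,
        HasSum (fun α : Fin n → ℕ =>
          (WeylEllipsoid.coeffF α a : ℂ) • WeylEllipsoid.hermiteProj α u) (A u)) := by
  have hE := WeylEllipsoid.volume_ellipsoid_ne_top ha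
  obtain ⟨A, hA⟩ := WeylEllipsoid.exists_weylOperator hE
  have hAW := WeylEllipsoid.isWeylQuantization_indicator
    (WeylEllipsoid.measurableSet_ellipsoid a) hE hA
  refine ⟨fun α => WeylEllipsoid.integrableOn_coeffIntegrand α a, ⟨A, hAW⟩, fun A' hA' u => ?_⟩
  -- Uniqueness replaces an arbitrary quantization by the constructed one, whose Wigner formula is
  -- known on all of `L²` and so on the Hermite functions.
  rw [hA'.unique hAW]
  refine WeylEllipsoid.hasSum_of_apply_hermiteL2
    (F := fun α => (WeylEllipsoid.coeffF α a : ℂ)) (fun α β => ?_) u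
  have h : ∀ p, WeylEllipsoid.wigner (WeylEllipsoid.hermiteL2 α) (WeylEllipsoid.hermiteL2 β) p =
      WeylEllipsoid.wigner (WeylEllipsoid.hermiteTensor α) (WeylEllipsoid.hermiteTensor β) p :=
    WeylEllipsoid.wigner_congr (WeylEllipsoid.memLp_hermiteTensor α).coeFn_toLp
      (WeylEllipsoid.memLp_hermiteTensor β).coeFn_toLp
  rw [hA]
  simp only [h]
  split_ifs with hαβ
  · subst hαβ
    exact WeylEllipsoid.setIntegral_ellipsoid_wigner_self a α
  · exact WeylEllipsoid.setIntegral_ellipsoid_wigner_of_ne a hαβ
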